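/- Let $M$ be a smooth manifold (Hausdorff, second countable, without boundary, not necessarily connected) and let $\pi$ be a Poisson structure on $M$, i.e. a smooth bivector field such that the bracket $\{f,g\}=\pi(df,dg)$ on $C^\infty(M)$ satisfies the Jacobi identity. Let $\rho\colon T^*M\to TM$ be contraction with $\pi$, and let $\mathcal F:=\rho(\Gamma_c(T^*M))$ be the $C^\infty(M)$-submodule of the vector fields on $M$ formed by the images of the compactly supported smooth $1$-forms. Call $(M,\pi)$ *almost regular* if there are a smooth real vector bundle $A\to M$ of constant finite rank and an isomorphism of $C^\infty(M)$-modules $\mathcal F\cong\Gamma_c(A)$, where $\Gamma_c(A)$ denotes the compactly supported smooth sections of $A$. **Proposition.** Let $k\ge 0$ be the integer such that $\wedge^k\pi$ is not identically zero and $\wedge^{k+1}\pi\equiv 0$ (here $\wedge^0\pi=1$). Then $(M,\pi)$ is almost regular if and only if both of the following hold: 1. the set $M_{\mathrm{reg}}:=\{x\in M : (\wedge^k\pi)_x\neq 0\}$ is dense in $M$; 2. there is a smooth vector subbundle $K\subset\wedge^{2k}TM$ of rank $1$ such that $\wedge^k\pi\in\Gamma(K)$. -/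

import Mathlib

open scoped Manifold ContDiff

noncomputable section

/-! ### Multilinear algebra of one vector space -/

section LinearAlgebra

variable {V : Type*} [AddCommGroup V] [Module ℝ V]

/-- The wedge power `∧^k w ∈ ∧^{2k} V` of a bivector `w ∈ ∧² V`, i.e. the `k`-th power of `w` in the
exterior algebra of `V`. -/
def wedgePow (w : ⋀[ℝ]^2 V) (k : ℕ) : ⋀[ℝ]^(2 * k) V :=
  ⟨(w : ExteriorAlgebra ℝ V) ^ k, by
    have h := Submodule.pow_mem_pow (⋀[ℝ]^2 V) w.2 k
    rwa [← pow_mul] at h⟩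

/-- Contraction of the bivector `w` with the covector `α`: the vector `w(α, ·)`. On a decomposable
bivector, `u ∧ v` is sent to `α(u) v - α(v) u`. -/
def bivectorSharp (w : ⋀[ℝ]^2 V) (α : V →ₗ[ℝ] ℝ) : V :=
  ExteriorAlgebra.ιInv (R := ℝ) (M := V)
    (CliffordAlgebra.contractLeft (Q := (0 : QuadraticForm ℝ V)) α (w : ExteriorAlgebra ℝ V))

end LinearAlgebra

section Manifold

variable {E : Type*} [NormedAddCommGroup E] [NormedSpace ℝ E]
  {H : Type*} [TopologicalSpace H] (I : ModelWithCorners ℝ E H)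
  {M : Type*} [TopologicalSpace M] [ChartedSpace H M] [IsManifold I ∞ M]

/-! ### Sections of vector bundles as modules over the smooth functions -/

section Sections

variable {I}
  {F : Type*} [NormedAddCommGroup F] [NormedSpace ℝ F]
  {V : M → Type*} [∀ x, AddCommGroup (V x)] [∀ x, Module ℝ (V x)]
  [∀ x, TopologicalSpace (V x)] [TopologicalSpace (Bundle.TotalSpace F V)]
  [FiberBundle F V] [VectorBundle ℝ F V]

/-- Pointwise multiplication of smooth sections by smooth functions. -/
instance smoothFunctionSMulSection : SMul C^∞⟮I, M; ℝ⟯ Cₛ^∞⟮I; F, V⟯ :=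
  ⟨fun f s ↦ ⟨fun x ↦ f x • s x, f.contMDiff.smul_section s.contMDiff⟩⟩

/-- The smooth sections of a vector bundle over `M` form a `C^∞(M)`-module. -/
instance smoothFunctionModuleSection : Module C^∞⟮I, M; ℝ⟯ Cₛ^∞⟮I; F, V⟯ where
  one_smul s := ContMDiffSection.ext fun x ↦ one_smul ℝ (s x)
  mul_smul f g s := ContMDiffSection.ext fun x ↦ mul_smul (f x) (g x) (s x)
  smul_zero f := ContMDiffSection.ext fun x ↦ smul_zero (f x)
  smul_add f s t := ContMDiffSection.ext fun x ↦ smul_add (f x) (s x) (t x)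
  add_smul f g s := ContMDiffSection.ext fun x ↦ add_smul (f x) (g x) (s x)
  zero_smul s := ContMDiffSection.ext fun x ↦ zero_smul ℝ (s x)

variable (I F V) in
/-- The `C^∞(M)`-module `Γ_c(V)` of compactly supported smooth sections of a vector bundle. -/
def compactSections : Submodule C^∞⟮I, M; ℝ⟯ Cₛ^∞⟮I; F, V⟯ where
  carrier := {s | IsCompact (closure {x : M | s x ≠ 0})}
  zero_mem' := by simp
  add_mem' {s t} hs ht := by
    refine (hs.union ht).of_isClosed_subset isClosed_closure ?_
    rw [← closure_union]
    refine closure_mono fun x hx ↦ ?_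
    by_contra hn
    simp only [Set.mem_union, Set.mem_ofPred_eq, not_or, not_not] at hn
    exact hx (by simp [hn.1, hn.2])
  smul_mem' f s hs := by
    refine hs.of_isClosed_subset isClosed_closure (closure_mono fun x hx hn ↦ hx ?_)
    change f x • s x = 0
    rw [hn, smul_zero]

end Sections

/-- The cotangent bundle `T^*M`, as the family of its fibres. -/
abbrev CotangentSpace (x : M) : Type _ := TangentSpace I x →L[ℝ] Bundle.Trivial M ℝ x

/-! ### Multivector fields -/

/-- The `p`-vector field `σ` (a section of `∧^p TM`) is smooth on the set `U`: in every chart of the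
preferred atlas its components are smooth. The tangent spaces over the chart domain are identified
with the model space `E` by the chart, and the components are the values of the linear functionals
on the finite-dimensional vector space `∧^p E`. -/
def SmoothMultivectorOn (p : ℕ) (σ : ∀ x : M, ⋀[ℝ]^p (TangentSpace I x)) (U : Set M) : Prop :=
  ∀ (x₀ : M) (ℓ : ⋀[ℝ]^p E →ₗ[ℝ] ℝ),
    ContMDiffOn I 𝓘(ℝ, ℝ) ∞
      (fun y ↦ ℓ (exteriorPower.map p
        ((trivializationAt E (TangentSpace I) x₀).continuousLinearMapAt ℝ y :
          TangentSpace I y →ₗ[ℝ] E) (σ y)))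
      (U ∩ (chartAt H x₀).source)

/-- The family of subspaces `K x ⊆ ∧^p T_xM` is a smooth vector subbundle of rank one of `∧^p TM`:
locally it is spanned by a nowhere vanishing smooth `p`-vector field. -/
def IsLineSubbundle (p : ℕ) (K : ∀ x : M, Submodule ℝ (⋀[ℝ]^p (TangentSpace I x))) : Prop :=
  ∀ x₀ : M, ∃ (U : Set M) (σ : ∀ x : M, ⋀[ℝ]^p (TangentSpace I x)),
    IsOpen U ∧ x₀ ∈ U ∧ SmoothMultivectorOn I p σ U ∧
      ∀ x ∈ U, σ x ≠ 0 ∧ K x = Submodule.span ℝ {σ x}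

/-! ### Poisson manifolds -/

/-- The differential of a real function at a point, as a covector. -/
def differentialAt (f : M → ℝ) (x : M) : CotangentSpace I x := mfderiv I 𝓘(ℝ, ℝ) f x

/-- The bracket `{f, g} = π(df, dg)` of a bivector field `π`. -/
def bivectorBracket (π : ∀ x : M, ⋀[ℝ]^2 (TangentSpace I x)) (f g : M → ℝ) (x : M) : ℝ :=
  differentialAt I g x (bivectorSharp (π x) (differentialAt I f x : TangentSpace I x →ₗ[ℝ] ℝ))

/-- A Poisson structure on `M`: a smooth bivector field whose bracket on `C^∞(M)` satisfies the
Jacobi identity. -/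
structure IsPoisson (π : ∀ x : M, ⋀[ℝ]^2 (TangentSpace I x)) : Prop where
  smooth : SmoothMultivectorOn I 2 π Set.univ
  jacobi : ∀ (f g h : C^∞⟮I, M; ℝ⟯) (x : M),
    bivectorBracket I π f (bivectorBracket I π g h) x
      + bivectorBracket I π g (bivectorBracket I π h f) x
      + bivectorBracket I π h (bivectorBracket I π f g) x = 0

/-- The singular foliation `ρ(Γ_c(T^*M))` of a bivector field `π`, where `ρ : T^*M → TM` is
contraction with `π`: the `C^∞(M)`-submodule of the vector fields consisting of the images of the
compactly supported smooth 1-forms. -/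
def poissonFoliation (π : ∀ x : M, ⋀[ℝ]^2 (TangentSpace I x)) :
    Submodule C^∞⟮I, M; ℝ⟯ Cₛ^∞⟮I; E, (TangentSpace I : M → Type _)⟯ where
  carrier := {X | ∃ α ∈ compactSections I (E →L[ℝ] ℝ) (fun x : M ↦ CotangentSpace I x),
    ∀ x : M, X x = bivectorSharp (π x) (α x : TangentSpace I x →ₗ[ℝ] ℝ)}
  zero_mem' := ⟨0, Submodule.zero_mem _, fun x ↦ by simp [bivectorSharp]⟩
  add_mem' := by
    rintro X Y ⟨α, hα, hX⟩ ⟨β, hβ, hY⟩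
    refine ⟨α + β, Submodule.add_mem _ hα hβ, fun x ↦ ?_⟩
    simp [bivectorSharp, hX x, hY x]
  smul_mem' := by
    rintro f X ⟨α, hα, hX⟩
    refine ⟨f • α, Submodule.smul_mem _ f hα, fun x ↦ ?_⟩
    change f x • X x = bivectorSharp (π x) ((f x • α x : CotangentSpace I x) :
      TangentSpace I x →ₗ[ℝ] ℝ)
    simp [bivectorSharp, hX x]

/-- A smooth real vector bundle over `M`, of constant finite rank. (Every such bundle is isomorphic
to one whose fibres live in the lowest universe, so that this restricts nothing.) -/
structure SmoothVectorBundleOver (M : Type*) [TopologicalSpace M] [ChartedSpace H M] where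
  rank : ℕ
  Fiber : M → Type
  [addCommGroup : ∀ x, AddCommGroup (Fiber x)]
  [module : ∀ x, Module ℝ (Fiber x)]
  [topologyFiber : ∀ x, TopologicalSpace (Fiber x)]
  [topologyTotal : TopologicalSpace (Bundle.TotalSpace (EuclideanSpace ℝ (Fin rank)) Fiber)]
  [fiberBundle : FiberBundle (EuclideanSpace ℝ (Fin rank)) Fiber]
  [vectorBundle : VectorBundle ℝ (EuclideanSpace ℝ (Fin rank)) Fiber]
  [smoothBundle : ContMDiffVectorBundle ∞ (EuclideanSpace ℝ (Fin rank)) Fiber I]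

attribute [instance] SmoothVectorBundleOver.addCommGroup SmoothVectorBundleOver.module
  SmoothVectorBundleOver.topologyFiber SmoothVectorBundleOver.topologyTotal
  SmoothVectorBundleOver.fiberBundle SmoothVectorBundleOver.vectorBundle
  SmoothVectorBundleOver.smoothBundle

/-- `(M, π)` is almost regular: its singular foliation is projective, that is, isomorphic as a
`C^∞(M)`-module to the compactly supported sections of some smooth vector bundle. -/
def IsAlmostRegular (π : ∀ x : M, ⋀[ℝ]^2 (TangentSpace I x)) : Prop :=
  ∃ A : SmoothVectorBundleOver I M,
    Nonempty (poissonFoliation I π ≃ₗ[C^∞⟮I, M; ℝ⟯]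
      compactSections I (EuclideanSpace ℝ (Fin A.rank)) A.Fiber)

end Manifold

end

/-! ### Bivectors of one vector space -/

section BivectorAlgebra

open ExteriorAlgebra CliffordAlgebra Module

variable {V : Type*} [AddCommGroup V] [Module ℝ V]

/-! Write `π♯` for contraction with `π`. Both sides of the equivalence amount, given density of the
regular set, to the local existence of an adapted frame (`IsAdaptedFrame`): vector fields `Y l` and
1-forms `α l`, `2k` of each, with `α l (Y m) = δ` and `π♯β = ∑ β(Y l) π♯(α l)` for every covector
`β`. By skew-symmetry the last identity also says `π♯β = ∑ α l (π♯β) Y l`, so the `Y l` span a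
smooth distribution of rank `2k` that contains the image of `π♯`, and equals it at regular points.

From projectivity to frames (`hasAdaptedFrames_of_equiv`, `dense_rank_le`): let `Φ` be an
isomorphism from the foliation to `Γ_c(A)`. Then `Φ ∘ π♯` is linear over functions, hence local. Its
components in a local frame of `A` are pairings with vector fields `Y l`, and the `α l` are
preimages of the frame sections. If `π♯` had rank below that of `A` on an open set, the sections
`Φ⁻¹(s i)` would satisfy a nontrivial smooth relation on a smaller open set
(`exists_smooth_relation`), and `Φ` would carry it to the frame of `A`. So `π♯` has at least the
rank of `A` on a dense set, which forces that rank to be `2k` and the regular set to be dense.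

From frames to the line bundle (`exists_lineSubbundle_of_hasAdaptedFrames`): take `K` spanned by the
wedge of the `Y l`. Two frames span the same spaces at regular points, hence everywhere by
continuity.

From the line bundle to frames (`hasAdaptedFrames_of_lineSubbundle`): contract a local generator `σ`
of `K` with all but one of `2k` fixed covectors and normalise. At regular points `σ` is proportional
to `∧^kπ`, for which Cramer's rule (`smul_bivectorSharp_eq_sum`) gives the identity; density extends
it.

From frames to projectivity (`isAlmostRegular_of_hasAdaptedFrames`): the matrices `α l (Y' m)` form
a smooth cocycle and so define a bundle `A`. The map `β ↦ (β(Y l))` sends `Γ_c(T^*M)` onto `Γ_c(A)`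
with the same kernel as `π♯`, so both images are the same quotient. -/

theorem bivector_induction {P : ⋀[ℝ]^2 V → Prop}
    (wedge : ∀ u v, P (exteriorPower.ιMulti ℝ 2 ![u, v]))
    (zero : P 0) (add : ∀ a b, P a → P b → P (a + b)) (smul : ∀ (c : ℝ) a, P a → P (c • a))
    (w : ⋀[ℝ]^2 V) : P w := by
  have hw : w ∈ Submodule.span ℝ (Set.range (exteriorPower.ιMulti ℝ 2 (M := V))) := by
    rw [exteriorPower.ιMulti_span]; trivial
  induction hw using Submodule.span_induction with
  | mem x h =>
    obtain ⟨a, rfl⟩ := h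
    have : a = ![a 0, a 1] := by ext i; fin_cases i <;> rfl
    rw [this]; exact wedge _ _
  | zero => exact zero
  | add x y _ _ hx hy => exact add _ _ hx hy
  | smul c x _ hx => exact smul _ _ hx

theorem coe_ιMulti_two (u v : V) :
    ((exteriorPower.ιMulti ℝ 2 ![u, v] : ⋀[ℝ]^2 V) : ExteriorAlgebra ℝ V)
      = ExteriorAlgebra.ι ℝ u * ExteriorAlgebra.ι ℝ v := by
  simp [ExteriorAlgebra.ιMulti_apply]

/-- Contraction of a covector with a bivector, as a bilinear map. -/
noncomputable def sharpHom : ⋀[ℝ]^2 V →ₗ[ℝ] Dual ℝ V →ₗ[ℝ] V :=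
  LinearMap.mk₂ ℝ (fun w α ↦ bivectorSharp w α) (by simp [bivectorSharp]) (by simp [bivectorSharp])
    (by simp [bivectorSharp]) (by simp [bivectorSharp])

theorem sharpHom_apply (w : ⋀[ℝ]^2 V) (α : Dual ℝ V) : sharpHom w α = bivectorSharp w α := rfl

theorem contractLeft_wedge (α : Dual ℝ V) (u v : V) :
    contractLeft (Q := (0 : QuadraticForm ℝ V)) α
      ((exteriorPower.ιMulti ℝ 2 ![u, v] : ⋀[ℝ]^2 V) : ExteriorAlgebra ℝ V)
      = ExteriorAlgebra.ι ℝ (α u • v - α v • u) := by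
  rw [coe_ιMulti_two]
  erw [contractLeft_ι_mul, contractLeft_ι]
  rw [map_sub, map_smul, map_smul, ← Algebra.commutes, ← Algebra.smul_def]

theorem bivectorSharp_wedge (α : Dual ℝ V) (u v : V) :
    bivectorSharp (exteriorPower.ιMulti ℝ 2 ![u, v] : ⋀[ℝ]^2 V) α = α u • v - α v • u := by
  rw [bivectorSharp, contractLeft_wedge, ExteriorAlgebra.ι_leftInverse]

theorem bivectorSharp_skew (w : ⋀[ℝ]^2 V) (α β : Dual ℝ V) :
    β (bivectorSharp w α) = - α (bivectorSharp w β) := by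
  induction w using bivector_induction with
  | wedge u v => simp [bivectorSharp_wedge]; ring
  | zero => simp [bivectorSharp]
  | add a b ha hb =>
    rw [← sharpHom_apply] at *
    simp only [← sharpHom_apply, map_add, LinearMap.add_apply] at *
    rw [ha, hb]; ring
  | smul c a ha =>
    simp only [← sharpHom_apply, map_smul, LinearMap.smul_apply, smul_eq_mul] at *
    rw [ha]; ring

theorem bivectorSharp_map {W : Type*} [AddCommGroup W] [Module ℝ W] (f : V →ₗ[ℝ] W)
    (w : ⋀[ℝ]^2 V) (α : Dual ℝ W) :
    bivectorSharp (exteriorPower.map 2 f w) α = f (bivectorSharp w (α ∘ₗ f)) := by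
  induction w using bivector_induction with
  | wedge u v =>
    rw [exteriorPower.map_apply_ιMulti]
    have : f ∘ ![u, v] = ![f u, f v] := by ext i; fin_cases i <;> rfl
    rw [this, bivectorSharp_wedge, bivectorSharp_wedge]; simp
  | zero => simp [bivectorSharp]
  | add a b ha hb =>
    simp only [← sharpHom_apply, map_add, LinearMap.add_apply] at *
    rw [ha, hb]
  | smul c a ha =>
    simp only [← sharpHom_apply, map_smul, LinearMap.smul_apply] at *
    rw [ha]

theorem bivector_commute_ι (w : ⋀[ℝ]^2 V) (v : V) :
    Commute (w : ExteriorAlgebra ℝ V) (ExteriorAlgebra.ι ℝ v) := by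
  have anti (a b : V) : ExteriorAlgebra.ι ℝ a * ExteriorAlgebra.ι ℝ b
      = - (ExteriorAlgebra.ι ℝ b * ExteriorAlgebra.ι ℝ a) :=
    eq_neg_of_add_eq_zero_left (ExteriorAlgebra.ι_add_mul_swap a b)
  induction w using bivector_induction with
  | wedge a b =>
    rw [coe_ιMulti_two, Commute, SemiconjBy, mul_assoc, anti b v, mul_neg, ← mul_assoc, anti a v,
      neg_mul, neg_neg, mul_assoc]
  | zero => exact Commute.zero_left _
  | add a b ha hb => exact Commute.add_left ha hb
  | smul c a ha => exact Commute.smul_left ha c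

/-- Contraction is an antiderivation, and no sign appears because a bivector is even. -/
theorem contractLeft_bivector_mul (w : ⋀[ℝ]^2 V) (α : Dual ℝ V) (x : ExteriorAlgebra ℝ V) :
    contractLeft (Q := (0 : QuadraticForm ℝ V)) α ((w : ExteriorAlgebra ℝ V) * x)
      = ExteriorAlgebra.ι ℝ (bivectorSharp w α) * x
        + (w : ExteriorAlgebra ℝ V) * contractLeft (Q := (0 : QuadraticForm ℝ V)) α x := by
  induction w using bivector_induction with
  | wedge u v =>
    rw [coe_ιMulti_two, mul_assoc, bivectorSharp_wedge]
    erw [contractLeft_ι_mul, contractLeft_ι_mul]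
    simp only [map_sub, map_smul, sub_mul, smul_mul_assoc, mul_sub, mul_smul_comm, mul_assoc]
    change _ - (_ - ExteriorAlgebra.ι ℝ u * (ExteriorAlgebra.ι ℝ v * _)) = _
    abel_nf
  | zero => simp [bivectorSharp]
  | add a b ha hb =>
    simp only [← sharpHom_apply, map_add, LinearMap.add_apply, Submodule.coe_add, add_mul] at *
    rw [ha, hb]; abel
  | smul c a ha =>
    simp only [← sharpHom_apply, map_smul, LinearMap.smul_apply, Submodule.coe_smul,
      smul_mul_assoc] at *
    rw [ha, smul_add]

theorem contractLeft_bivector_pow_mul (w : ⋀[ℝ]^2 V) (α : Dual ℝ V) (j : ℕ)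
    (x : ExteriorAlgebra ℝ V) :
    contractLeft (Q := (0 : QuadraticForm ℝ V)) α ((w : ExteriorAlgebra ℝ V) ^ (j + 1) * x)
      = ((j + 1 : ℕ) : ℝ) •
          ((w : ExteriorAlgebra ℝ V) ^ j * (ExteriorAlgebra.ι ℝ (bivectorSharp w α) * x))
        + (w : ExteriorAlgebra ℝ V) ^ (j + 1)
          * contractLeft (Q := (0 : QuadraticForm ℝ V)) α x := by
  have hc := fun n ↦ (bivector_commute_ι w (bivectorSharp w α)).pow_left n
  induction j with
  | zero => simp [contractLeft_bivector_mul]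
  | succ j ih =>
    rw [pow_succ', mul_assoc, contractLeft_bivector_mul, ih, mul_add, mul_smul_comm, ← mul_assoc,
      ← mul_assoc, ← mul_assoc, ← mul_assoc, ← mul_assoc, ← pow_succ', (hc (j + 1)).eq, ← add_assoc]
    push_cast
    rw [add_smul ((j : ℝ) + 1), one_smul, add_comm (_ • _)]

/-! ### Vanishing of wedge powers bounds the rank of the contraction. -/

/-- Contraction lowers the degree of products of vectors in a fixed subspace. -/
theorem contractLeft_mem_pow (D : Submodule ℝ V) (α : Dual ℝ V) (m : ℕ)
    {x : ExteriorAlgebra ℝ V} (hx : x ∈ (D.map (ExteriorAlgebra.ι ℝ)) ^ (m + 1)) :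
    contractLeft (Q := (0 : QuadraticForm ℝ V)) α x ∈ (D.map (ExteriorAlgebra.ι ℝ)) ^ m := by
  induction m generalizing x with
  | zero =>
    rw [zero_add, pow_one] at hx
    obtain ⟨v, -, rfl⟩ := hx
    erw [contractLeft_ι, pow_zero]
    exact Submodule.algebraMap_mem _
  | succ m ih =>
    rw [pow_succ'] at hx
    refine Submodule.mul_induction_on hx ?_ fun a b ha hb ↦ ?_
    · rintro _ ⟨v, hv, rfl⟩ y hy
      erw [contractLeft_ι_mul]
      refine Submodule.sub_mem _ (Submodule.smul_mem _ _ hy) ?_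
      rw [pow_succ']
      exact Submodule.mul_mem_mul ⟨v, hv, rfl⟩ (ih hy)
    · rw [map_add]; exact Submodule.add_mem _ ha hb

/-- One power of `w` is traded for two vectors of the image: contracting `w^(j+1) y = 0` with `α`
produces the factor `w♯α`, and a further factor `v` from the image restores the degree that
contraction removed from `y`, so that the error term vanishes by hypothesis. -/
theorem pow_mul_eq_zero_of_succ {w : ⋀[ℝ]^2 V} {j m : ℕ}
    (h : ∀ x ∈ ((LinearMap.range (sharpHom w)).map (ExteriorAlgebra.ι ℝ)) ^ (m + 1),
      (w : ExteriorAlgebra ℝ V) ^ (j + 1) * x = 0) :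
    ∀ x ∈ ((LinearMap.range (sharpHom w)).map (ExteriorAlgebra.ι ℝ)) ^ (m + 3),
      (w : ExteriorAlgebra ℝ V) ^ j * x = 0 := by
  intro x hx
  rw [pow_succ, pow_succ' _ (m + 1), mul_assoc] at hx
  refine Submodule.mul_induction_on hx ?_ fun a b ha hb ↦ by rw [mul_add, ha, hb, add_zero]
  rintro _ ⟨_, ⟨α, rfl⟩, rfl⟩ z hz
  refine Submodule.mul_induction_on hz ?_ fun a b ha hb ↦ by rw [mul_add, mul_add, ha, hb, add_zero]
  intro y hy v hv
  have h1 := contractLeft_bivector_pow_mul w α j y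
  rw [h y hy, map_zero] at h1
  have h2 : (w : ExteriorAlgebra ℝ V) ^ (j + 1)
      * (contractLeft (Q := (0 : QuadraticForm ℝ V)) α y * v) = 0 :=
    h _ (by rw [pow_succ]; exact Submodule.mul_mem_mul (contractLeft_mem_pow _ α m hy) hv)
  have h3 := congrArg (· * v) h1
  simp only [zero_mul, add_mul, mul_assoc] at h3
  rw [h2, add_zero, smul_mul_assoc, eq_comm, smul_eq_zero] at h3
  have := h3.resolve_left (by positivity)
  simpa only [mul_assoc, sharpHom_apply] using this

/-- Contracting `w^(j+1) = 0` once gives `w^j ∧ w♯α = 0`; trading the remaining `j` powers two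
vectors at a time leaves products of `2j + 1` vectors. No normal form of `w` is needed. -/
theorem range_sharp_pow_eq_zero_of_pow_eq_zero {w : ⋀[ℝ]^2 V} {j : ℕ}
    (h : (w : ExteriorAlgebra ℝ V) ^ (j + 1) = 0) :
    ((LinearMap.range (sharpHom w)).map (ExteriorAlgebra.ι ℝ)) ^ (2 * j + 1) = ⊥ := by
  have key : ∀ i ≤ j, ∀ x ∈ ((LinearMap.range (sharpHom w)).map (ExteriorAlgebra.ι ℝ)) ^ (2 * i + 1),
      (w : ExteriorAlgebra ℝ V) ^ (j - i) * x = 0 := by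
    intro i
    induction i with
    | zero =>
      intro _ x hx
      rw [mul_zero, zero_add, pow_one] at hx
      obtain ⟨_, ⟨α, rfl⟩, rfl⟩ := hx
      have h1 := contractLeft_bivector_pow_mul w α j 1
      rw [h, zero_mul, map_zero, zero_mul, add_zero, mul_one, eq_comm, smul_eq_zero] at h1
      exact h1.resolve_left (by positivity)
    | succ i ih =>
      intro hi
      refine pow_mul_eq_zero_of_succ (m := 2 * i) ?_
      have := ih (by omega)
      rwa [show j - i = j - (i + 1) + 1 by omega] at this
  rw [eq_bot_iff]
  intro x hx
  simpa using key j le_rfl x hx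

theorem ιMulti_mem_map_pow (D : Submodule ℝ V) {m : ℕ} (v : Fin m → V) (hv : ∀ i, v i ∈ D) :
    ExteriorAlgebra.ιMulti ℝ m v ∈ (D.map (ExteriorAlgebra.ι ℝ)) ^ m := by
  induction m with
  | zero => simp
  | succ m ih =>
    rw [ExteriorAlgebra.ιMulti_succ_apply, pow_succ']
    exact Submodule.mul_mem_mul ⟨_, hv 0, rfl⟩ (ih _ fun i ↦ hv _)

theorem ιMulti_ne_zero_of_dual {m : ℕ} {v : Fin m → V} {α : Fin m → Dual ℝ V}
    (h : ∀ i j, α i (v j) = if i = j then 1 else 0) : exteriorPower.ιMulti ℝ m v ≠ 0 := by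
  intro h0
  have := exteriorPower.pairingDual_ιMulti_ιMulti α v
  rw [h0, map_zero] at this
  have h1 : (Matrix.of fun i j ↦ α j (v i)) = (1 : Matrix (Fin m) (Fin m) ℝ) := by
    ext i j; simp [h, Matrix.one_apply, eq_comm]
  rw [h1, Matrix.det_one] at this
  exact zero_ne_one this

theorem exists_dual_of_linearIndependent {m : ℕ} {v : Fin m → V} (h : LinearIndependent ℝ v) :
    ∃ α : Fin m → Dual ℝ V, ∀ i j, α i (v j) = if i = j then 1 else 0 := by
  obtain ⟨f, hf⟩ := (Fintype.linearCombination ℝ v).exists_leftInverse_of_injective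
    (LinearMap.ker_eq_bot.2 h.fintypeLinearCombination_injective)
  refine ⟨fun i ↦ LinearMap.proj i ∘ₗ f, fun i j ↦ ?_⟩
  have := congrFun (LinearMap.congr_fun hf (Pi.single j 1)) i
  simpa [Fintype.linearCombination_apply_single, Pi.single_apply] using this

theorem ιMulti_ne_zero_of_linearIndependent {m : ℕ} {v : Fin m → V} (h : LinearIndependent ℝ v) :
    exteriorPower.ιMulti ℝ m v ≠ 0 := by
  obtain ⟨α, hα⟩ := exists_dual_of_linearIndependent h
  exact ιMulti_ne_zero_of_dual hα

/-- Otherwise `2j + 1` independent vectors of the image would have zero wedge product. -/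
theorem finrank_range_sharp_lt [FiniteDimensional ℝ V] {w : ⋀[ℝ]^2 V} {j : ℕ}
    (h : wedgePow w (j + 1) = 0) : Module.finrank ℝ (LinearMap.range (sharpHom w)) < 2 * j + 1 := by
  have h0 : (w : ExteriorAlgebra ℝ V) ^ (j + 1) = 0 := congrArg Subtype.val h
  by_contra! hle
  have h1 := range_sharp_pow_eq_zero_of_pow_eq_zero h0
  let b := Module.finBasis ℝ (LinearMap.range (sharpHom w))
  let v : Fin (2 * j + 1) → V := fun i ↦ b (Fin.castLE hle i)
  have hv : LinearIndependent ℝ v :=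
    (b.linearIndependent.map' (Submodule.subtype _) (Submodule.ker_subtype _)).comp _
      (Fin.castLE_injective hle)
  have h2 := ιMulti_mem_map_pow (LinearMap.range (sharpHom w)) v fun i ↦ Subtype.prop _
  rw [h1] at h2
  exact ιMulti_ne_zero_of_linearIndependent hv (Subtype.ext h2)

/-! ### Multivectors supported on the span of a family. -/

/-- The part of degree `m` of the subalgebra generated by the span of a family. -/
theorem span_map_pow_eq {p : ℕ} (Y : Fin p → V) (m : ℕ) :
    ((Submodule.span ℝ (Set.range Y)).map (ExteriorAlgebra.ι ℝ)) ^ m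
      = (⋀[ℝ]^m (Fin p → ℝ)).map
        (ExteriorAlgebra.map (Fintype.linearCombination ℝ Y)).toLinearMap := by
  rw [Submodule.map_pow, ← Fintype.range_linearCombination ℝ]
  congr 1
  ext x
  constructor
  · rintro ⟨_, ⟨c, rfl⟩, rfl⟩
    exact ⟨_, ⟨c, rfl⟩, ExteriorAlgebra.map_apply_ι _ _⟩
  · rintro ⟨_, ⟨c, rfl⟩, rfl⟩
    exact ⟨_, ⟨c, rfl⟩, (ExteriorAlgebra.map_apply_ι _ _).symm⟩

theorem span_map_pow_eq_bot {p : ℕ} (Y : Fin p → V) {m : ℕ} (h : p < m) :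
    ((Submodule.span ℝ (Set.range Y)).map (ExteriorAlgebra.ι ℝ)) ^ m = ⊥ := by
  rw [span_map_pow_eq]
  have : ⋀[ℝ]^m (Fin p → ℝ) = ⊥ := by
    rw [← Submodule.finrank_eq_zero (R := ℝ), exteriorPower.finrank_eq]
    simpa using Nat.choose_eq_zero_of_lt h
  rw [this, Submodule.map_bot]

theorem mem_span_ιMulti {p : ℕ} (Y : Fin p → V) {σ : ⋀[ℝ]^p V}
    (h : (σ : ExteriorAlgebra ℝ V)
      ∈ ((Submodule.span ℝ (Set.range Y)).map (ExteriorAlgebra.ι ℝ)) ^ p) :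
    ∃ c : ℝ, σ = c • exteriorPower.ιMulti ℝ p Y := by
  rw [span_map_pow_eq] at h
  obtain ⟨x, hx, hxσ⟩ := h
  have h1 : Module.finrank ℝ (⋀[ℝ]^p (Fin p → ℝ)) = 1 := by
    rw [exteriorPower.finrank_eq]; simp
  have h2 : exteriorPower.ιMulti ℝ p (fun i : Fin p ↦ (Pi.single i 1 : Fin p → ℝ)) ≠ 0 :=
    ιMulti_ne_zero_of_linearIndependent (Pi.linearIndependent_single_one _ _)
  obtain ⟨c, hc⟩ := (finrank_eq_one_iff_of_nonzero' _ h2).1 h1 ⟨x, hx⟩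
  refine ⟨c, Subtype.ext ?_⟩
  rw [← hxσ, ← show _ = x from congrArg Subtype.val hc]
  simp only [Submodule.coe_smul, AlgHom.toLinearMap_apply, map_smul,
    exteriorPower.ιMulti_apply_coe, ExteriorAlgebra.map_apply_ιMulti]
  congr 2
  ext i
  simp [Fintype.linearCombination_apply_single]

section FiniteDimensional

variable [FiniteDimensional ℝ V]

theorem two_smul_bivector {ι : Type*} [Fintype ι] (b : Basis ι ℝ V) (w : ⋀[ℝ]^2 V) :
    (2 : ℝ) • (w : ExteriorAlgebra ℝ V)
      = ∑ i, ExteriorAlgebra.ι ℝ (b i) * ExteriorAlgebra.ι ℝ (bivectorSharp w (b.coord i)) := by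
  induction w using bivector_induction with
  | wedge u v =>
    have h (u v : V) : ∑ i, ExteriorAlgebra.ι ℝ (b i) * ExteriorAlgebra.ι ℝ (b.repr u i • v)
        = ExteriorAlgebra.ι ℝ u * ExteriorAlgebra.ι ℝ v := by
      conv_rhs => rw [← b.sum_repr u]
      simp only [map_smul, mul_smul_comm, map_sum, Finset.sum_mul, smul_mul_assoc]
    simp only [bivectorSharp_wedge, map_sub, mul_sub, Finset.sum_sub_distrib, Basis.coord_apply]
    rw [h, h, coe_ιMulti_two, two_smul,
      eq_neg_of_add_eq_zero_left (ExteriorAlgebra.ι_add_mul_swap v u), sub_neg_eq_add]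
  | zero => simp [bivectorSharp]
  | add a c ha hc =>
    simp only [← sharpHom_apply, map_add, LinearMap.add_apply, Submodule.coe_add, smul_add,
      mul_add, Finset.sum_add_distrib] at *
    rw [ha, hc]
  | smul c a ha =>
    simp only [← sharpHom_apply, map_smul, LinearMap.smul_apply, Submodule.coe_smul,
      mul_smul_comm, ← Finset.smul_sum] at *
    rw [← ha, smul_comm]

/-- Let `T` be the identity minus a projection onto `D`. In `2w = ∑ b i ∧ w♯(b^i)` the second
factors lie in `D`. Applying `T` to the first factors gives zero, since by skew-symmetry `T` can be
moved onto the vectors `w♯(b^j)`, which it kills; so the first factors may be projected to `D` as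
well. -/
theorem bivector_mem_of_range_le {w : ⋀[ℝ]^2 V} {D : Submodule ℝ V}
    (h : ∀ α, bivectorSharp w α ∈ D) :
    (w : ExteriorAlgebra ℝ V) ∈ (D.map (ExteriorAlgebra.ι ℝ)) ^ 2 := by
  let b := Module.finBasis ℝ V
  obtain ⟨q, hq⟩ := D.subtype.exists_leftInverse_of_injective (Submodule.ker_subtype D)
  let T : V →ₗ[ℝ] V := LinearMap.id - D.subtype ∘ₗ q
  have hT : ∀ v ∈ D, T v = 0 := fun v hv ↦ by
    have := LinearMap.congr_fun hq ⟨v, hv⟩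
    simp only [LinearMap.comp_apply, Submodule.subtype_apply, LinearMap.id_apply] at this
    simp [T, this]
  have h0 : ∑ i, ExteriorAlgebra.ι ℝ (T (b i))
      * ExteriorAlgebra.ι ℝ (bivectorSharp w (b.coord i)) = 0 := by
    calc _ = ∑ i, ∑ j, ExteriorAlgebra.ι ℝ (T (b i))
            * ExteriorAlgebra.ι ℝ (b.coord j (bivectorSharp w (b.coord i)) • b j) := by
          refine Finset.sum_congr rfl fun i _ ↦ ?_
          rw [← Finset.mul_sum, ← map_sum]
          simp only [Basis.coord_apply, b.sum_repr]
      _ = ∑ j, ∑ i, -(ExteriorAlgebra.ι ℝ (T (b.coord i (bivectorSharp w (b.coord j)) • b i))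
            * ExteriorAlgebra.ι ℝ (b j)) := by
          rw [Finset.sum_comm]
          refine Finset.sum_congr rfl fun j _ ↦ Finset.sum_congr rfl fun i _ ↦ ?_
          rw [bivectorSharp_skew]
          simp only [neg_smul, map_smul, map_neg, mul_neg, mul_smul_comm, smul_mul_assoc]
      _ = ∑ j, -(ExteriorAlgebra.ι ℝ (T (bivectorSharp w (b.coord j)))
            * ExteriorAlgebra.ι ℝ (b j)) := by
          refine Finset.sum_congr rfl fun j _ ↦ ?_
          rw [Finset.sum_neg_distrib, ← Finset.sum_mul, ← map_sum, ← map_sum]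
          simp only [Basis.coord_apply, b.sum_repr]
      _ = 0 := by simp [hT _ (h _)]
  have h1 := two_smul_bivector b w
  have h2 : (2 : ℝ) • (w : ExteriorAlgebra ℝ V) ∈ (D.map (ExteriorAlgebra.ι ℝ)) ^ 2 := by
    rw [h1, ← sub_zero (∑ i, _), ← h0, ← Finset.sum_sub_distrib]
    refine Submodule.sum_mem _ fun i _ ↦ ?_
    rw [← sub_mul, ← map_sub, pow_two]
    refine Submodule.mul_mem_mul ⟨_, ?_, rfl⟩ ⟨_, h _, rfl⟩
    simp [T]
  have h3 := Submodule.smul_mem _ (2⁻¹ : ℝ) h2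
  rwa [smul_smul, inv_mul_cancel₀ two_ne_zero, one_smul] at h3

theorem wedgePow_mem_of_range_le {w : ⋀[ℝ]^2 V} {D : Submodule ℝ V}
    (h : ∀ α, bivectorSharp w α ∈ D) (k : ℕ) :
    (wedgePow w k : ExteriorAlgebra ℝ V) ∈ (D.map (ExteriorAlgebra.ι ℝ)) ^ (2 * k) := by
  rw [pow_mul]
  exact Submodule.pow_mem_pow _ (bivector_mem_of_range_le h) k

theorem wedgePow_eq_smul_ιMulti {w : ⋀[ℝ]^2 V} {k : ℕ} (Y : Fin (2 * k) → V)
    (h : ∀ α, bivectorSharp w α ∈ Submodule.span ℝ (Set.range Y)) :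
    ∃ c : ℝ, wedgePow w k = c • exteriorPower.ιMulti ℝ (2 * k) Y :=
  mem_span_ιMulti Y (wedgePow_mem_of_range_le h k)

theorem le_of_wedgePow_ne_zero {w : ⋀[ℝ]^2 V} {k p : ℕ} (hw : wedgePow w k ≠ 0) (Y : Fin p → V)
    (h : ∀ α, bivectorSharp w α ∈ Submodule.span ℝ (Set.range Y)) : 2 * k ≤ p := by
  by_contra! hlt
  have h1 := wedgePow_mem_of_range_le h k
  rw [span_map_pow_eq_bot Y hlt] at h1
  exact hw (Subtype.ext h1)

theorem exists_spanning_range_sharp (w : ⋀[ℝ]^2 V) {p : ℕ}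
    (hp : Module.finrank ℝ (LinearMap.range (sharpHom w)) = p) :
    ∃ Y : Fin p → V, Submodule.span ℝ (Set.range Y) = LinearMap.range (sharpHom w) := by
  subst hp
  let b := Module.finBasis ℝ (LinearMap.range (sharpHom w))
  refine ⟨fun i ↦ b i, ?_⟩
  have : Set.range (fun i ↦ (b i : V)) = (LinearMap.range (sharpHom w)).subtype '' Set.range b := by
    rw [← Set.range_comp]; rfl
  rw [this, ← Submodule.map_span, b.span_eq, Submodule.map_top, Submodule.range_subtype]

theorem two_mul_le_finrank_of_wedgePow_ne_zero {w : ⋀[ℝ]^2 V} {k : ℕ} (hw : wedgePow w k ≠ 0) :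
    2 * k ≤ Module.finrank ℝ (LinearMap.range (sharpHom w)) := by
  obtain ⟨Y, hY⟩ := exists_spanning_range_sharp w rfl
  exact le_of_wedgePow_ne_zero hw Y fun α ↦ by rw [hY]; exact ⟨α, rfl⟩

/-- With `two_mul_le_finrank_of_wedgePow_ne_zero`, this turns nonvanishing of `∧^k` into the
condition that the rank is at least `2k`. -/
theorem wedgePow_ne_zero_of_le_finrank {w : ⋀[ℝ]^2 V} {k : ℕ}
    (h : 2 * k ≤ Module.finrank ℝ (LinearMap.range (sharpHom w))) : wedgePow w k ≠ 0 := by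
  cases k with
  | zero =>
    intro h0
    have h1 := congrArg Subtype.val h0
    simp [wedgePow] at h1
  | succ k => exact fun h0 ↦ absurd (finrank_range_sharp_lt h0) (by omega)

theorem finrank_range_sharp_eq {w : ⋀[ℝ]^2 V} {k : ℕ} (hw : wedgePow w k ≠ 0)
    (hw' : wedgePow w (k + 1) = 0) :
    Module.finrank ℝ (LinearMap.range (sharpHom w)) = 2 * k :=
  le_antisymm (Nat.lt_succ_iff.1 (finrank_range_sharp_lt hw'))
    (two_mul_le_finrank_of_wedgePow_ne_zero hw)

theorem bivectorSharp_eq_zero_of_annihilates {w : ⋀[ℝ]^2 V} {γ : Dual ℝ V}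
    (h : ∀ α, γ (bivectorSharp w α) = 0) : bivectorSharp w γ = 0 := by
  rw [← Module.forall_dual_apply_eq_zero_iff ℝ]
  intro φ
  rw [bivectorSharp_skew, h, neg_zero]

/-! ### Pairing with covectors and Cramer's rule. -/

/-- The determinant pairing of a multivector with a family of covectors. -/
noncomputable def multiPair {p : ℕ} (σ : ⋀[ℝ]^p V) (α : Fin p → Dual ℝ V) : ℝ :=
  exteriorPower.pairingDual ℝ V p (exteriorPower.ιMulti ℝ p α) σ

theorem multiPair_ιMulti {p : ℕ} (v : Fin p → V) (α : Fin p → Dual ℝ V) :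
    multiPair (exteriorPower.ιMulti ℝ p v) α = Matrix.det (.of fun i j ↦ α j (v i)) :=
  exteriorPower.pairingDual_ιMulti_ιMulti α v

theorem multiPair_smul {p : ℕ} (c : ℝ) (σ : ⋀[ℝ]^p V) (α : Fin p → Dual ℝ V) :
    multiPair (c • σ) α = c * multiPair σ α := by simp [multiPair]

/-- The vector obtained from a multivector by pairing with all covectors but the `l`-th. -/
noncomputable def pairVector {p : ℕ} (α : Fin p → Dual ℝ V) (l : Fin p) :
    ⋀[ℝ]^p V →ₗ[ℝ] V :=
  (Module.evalEquiv ℝ V).symm.toLinearMap ∘ₗ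
    (((exteriorPower.pairingDual ℝ V p) ∘ₗ
      ((exteriorPower.ιMulti ℝ p (M := Dual ℝ V)).toMultilinearMap.toLinearMap α l))).flip

theorem apply_pairVector {p : ℕ} (α : Fin p → Dual ℝ V) (l : Fin p) (σ : ⋀[ℝ]^p V)
    (β : Dual ℝ V) : β (pairVector α l σ) = multiPair σ (Function.update α l β) := by
  rw [pairVector, LinearMap.comp_apply, LinearEquiv.coe_coe, Module.apply_evalEquiv_symm_apply]
  rfl

theorem multiPair_update_self {p : ℕ} (α : Fin p → Dual ℝ V) (l m : Fin p) (σ : ⋀[ℝ]^p V) :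
    multiPair σ (Function.update α l (α m)) = if m = l then multiPair σ α else 0 := by
  split_ifs with h
  · subst h; rw [Function.update_eq_self]
  · rw [multiPair, AlternatingMap.map_update_self _ _ (Ne.symm h)]; simp

theorem exists_multiPair_ne_zero {p : ℕ} {σ : ⋀[ℝ]^p V} (h : σ ≠ 0) :
    ∃ α : Fin p → Dual ℝ V, multiPair σ α ≠ 0 := by
  by_contra! h0
  let b := Module.finBasis ℝ V
  apply h
  apply (b.exteriorPower p).ext_elem
  intro s
  rw [exteriorPower.basis_repr_apply, map_zero, Finsupp.zero_apply]
  exact h0 _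

/-- Cramer's rule, with `∧^k w` in the role of the determinant: it is a multiple of the wedge of a
basis `Y` of the image. The identity is homogeneous in `∧^k w`, so at regular points any generator
of the same line can replace it. -/
theorem smul_bivectorSharp_eq_sum {w : ⋀[ℝ]^2 V} {k : ℕ} (hw : wedgePow w k ≠ 0)
    (hw' : wedgePow w (k + 1) = 0) (α : Fin (2 * k) → Dual ℝ V) (β : Dual ℝ V) :
    multiPair (wedgePow w k) α • bivectorSharp w β
      = ∑ l, multiPair (wedgePow w k) (Function.update α l β) • bivectorSharp w (α l) := by
  obtain ⟨Y, hY⟩ := exists_spanning_range_sharp w (finrank_range_sharp_eq hw hw')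
  obtain ⟨c, hc⟩ := wedgePow_eq_smul_ιMulti (w := w) Y fun α ↦ by rw [hY]; exact ⟨α, rfl⟩
  let A : Matrix (Fin (2 * k)) (Fin (2 * k)) ℝ := .of fun i j ↦ α j (Y i)
  have h1 (l) : multiPair (wedgePow w k) (Function.update α l β)
      = c * A.cramer (fun i ↦ β (Y i)) l := by
    rw [hc, multiPair_smul, multiPair_ιMulti, Matrix.cramer_apply]
    congr 2
    ext i j
    by_cases hj : j = l
    · subst hj; simp
    · simp [hj, A]
  have h2 : multiPair (wedgePow w k) α = c * A.det := by
    rw [hc, multiPair_smul, multiPair_ιMulti]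
  -- By Cramer's rule `γ` kills every `Y i`, hence the image of `w♯`; skew-symmetry then puts `γ` in
  -- the kernel.
  let γ : Dual ℝ V := (c * A.det) • β - ∑ l, (c * A.cramer (fun i ↦ β (Y i)) l) • α l
  have h3 : ∀ v ∈ Submodule.span ℝ (Set.range Y), γ v = 0 := by
    intro v hv
    induction hv using Submodule.span_induction with
    | mem x h =>
      obtain ⟨i, rfl⟩ := h
      have := congrFun (Matrix.mulVec_cramer A fun i ↦ β (Y i)) i
      simp only [Matrix.mulVec, dotProduct, Pi.smul_apply, smul_eq_mul] at this
      simp only [γ, LinearMap.sub_apply, LinearMap.smul_apply, LinearMap.sum_apply, smul_eq_mul,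
        mul_assoc, ← this, Finset.mul_sum, sub_eq_zero]
      refine Finset.sum_congr rfl fun l _ ↦ ?_
      simp only [A, Matrix.of_apply]
      ring
    | zero => exact map_zero _
    | add x y _ _ hx hy => rw [map_add, hx, hy, add_zero]
    | smul a x _ hx => rw [map_smul, hx, smul_zero]
  have h4 : bivectorSharp w γ = 0 :=
    bivectorSharp_eq_zero_of_annihilates fun α ↦ h3 _ (by rw [hY]; exact ⟨α, rfl⟩)
  rw [← sharpHom_apply] at h4
  simp only [γ, map_sub, map_smul, map_sum, sharpHom_apply, sub_eq_zero] at h4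
  simp only [h1, h2, h4]

end FiniteDimensional

end BivectorAlgebra

/-! ### Smooth sections over open sets -/

section SmoothSections

open Bundle (TotalSpace Trivialization contMDiffAt_section contMDiffWithinAt_section)
open Module Set Topology

variable {E : Type*} [NormedAddCommGroup E] [NormedSpace ℝ E]
  {H : Type*} [TopologicalSpace H] (I : ModelWithCorners ℝ E H)
  {M : Type*} [TopologicalSpace M] [ChartedSpace H M]

section GeneralBundle

variable (F : Type*) [NormedAddCommGroup F] [NormedSpace ℝ F]
  {V : M → Type*} [∀ x, AddCommGroup (V x)] [∀ x, Module ℝ (V x)]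
  [∀ x, TopologicalSpace (V x)] [TopologicalSpace (Bundle.TotalSpace F V)]
  [FiberBundle F V]

/-- The section `s` of a vector bundle is smooth on the set `U`. -/
abbrev SmoothSectionOn (s : ∀ x, V x) (U : Set M) : Prop :=
  ContMDiffOn I (I.prod 𝓘(ℝ, F)) ∞ (fun x ↦ (TotalSpace.mk' F x (s x) : TotalSpace F V)) U

variable {I F} [VectorBundle ℝ F V]

/-- A smooth section over an open set which vanishes on a dense set is zero. -/
theorem SmoothSectionOn.eq_zero_of_dense {s : ∀ x, V x} {U S : Set M} (hU : IsOpen U)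
    (hS : Dense S) (hs : SmoothSectionOn I F s U) (h0 : ∀ x ∈ U, x ∈ S → s x = 0) :
    ∀ x ∈ U, s x = 0 := by
  intro x hx
  set e := trivializationAt F V x
  have hxe : x ∈ e.baseSet := mem_baseSet_trivializationAt F V x
  have hc : ContinuousAt (fun y ↦ (e ⟨y, s y⟩).2) x :=
    ((contMDiffAt_section x).1 ((hs x hx).contMDiffAt (hU.mem_nhds hx))).continuousAt
  have hW : IsOpen (U ∩ e.baseSet) := hU.inter e.open_baseSet
  have hcl : x ∈ closure ((U ∩ e.baseSet) ∩ S) :=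
    hS.open_subset_closure_inter hW ⟨hx, hxe⟩
  have hz : (e ⟨x, s x⟩).2 ∈ ({0} : Set F) := by
    refine (isClosed_singleton).closure_subset (hc.continuousWithinAt.mem_closure hcl ?_)
    rintro y ⟨⟨hyU, hye⟩, hyS⟩
    simp only [h0 y hyU hyS]
    exact congr_arg Prod.snd (e.zeroSection ℝ hye)
  have h1 : e.continuousLinearMapAt ℝ x (s x) = 0 := by
    rw [Trivialization.continuousLinearMapAt_apply_of_mem (R := ℝ) e hxe]; exact hz
  rw [← e.symmL_continuousLinearMapAt (R := ℝ) hxe (s x), h1, map_zero]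

theorem ContMDiffOn.eq_zero_of_dense {f : M → ℝ} {U S : Set M} (hU : IsOpen U)
    (hS : Dense S) (hf : ContMDiffOn I 𝓘(ℝ, ℝ) ∞ f U) (h0 : ∀ x ∈ U, x ∈ S → f x = 0) :
    ∀ x ∈ U, f x = 0 := by
  intro x hx
  have hz : f x ∈ ({0} : Set ℝ) := by
    refine (isClosed_singleton).closure_subset
      ((hf.continuousOn.continuousAt (hU.mem_nhds hx)).continuousWithinAt.mem_closure
        (hS.open_subset_closure_inter hU hx) ?_)
    rintro y ⟨hyU, hyS⟩
    exact h0 y hyU hyS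
  exact hz

theorem SmoothSectionOn.mono {s : ∀ x, V x} {U W : Set M} (hs : SmoothSectionOn I F s U)
    (h : W ⊆ U) : SmoothSectionOn I F s W := ContMDiffOn.mono hs h

theorem SmoothSectionOn.smul {s : ∀ x, V x} {U : Set M} {f : M → ℝ}
    (hf : ContMDiffOn I 𝓘(ℝ, ℝ) ∞ f U) (hs : SmoothSectionOn I F s U) :
    SmoothSectionOn I F (fun x ↦ f x • s x) U := hf.smul_section hs

theorem SmoothSectionOn.sum {ι : Type*} {t : Finset ι} {s : ι → ∀ x, V x} {U : Set M}
    (hs : ∀ i ∈ t, SmoothSectionOn I F (s i) U) :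
    SmoothSectionOn I F (fun x ↦ ∑ i ∈ t, s i x) U := ContMDiffOn.sum_section hs

theorem SmoothSectionOn.sub {s t : ∀ x, V x} {U : Set M} (hs : SmoothSectionOn I F s U)
    (ht : SmoothSectionOn I F t U) : SmoothSectionOn I F (fun x ↦ s x - t x) U :=
  ContMDiffOn.sub_section hs ht

/-- Extension by zero of a section on an open set, after multiplication by a cut-off function. -/
noncomputable def cutoffSection (χ : C^∞⟮I, M; ℝ⟯) {U : Set M} (hU : IsOpen U) (hχ : tsupport χ ⊆ U)
    (s : ∀ x, V x) (hs : SmoothSectionOn I F s U) : Cₛ^∞⟮I; F, V⟯ :=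
  ⟨fun x ↦ χ x • s x, χ.contMDiff.contMDiffOn.smul_section_of_tsupport hU hχ hs⟩

theorem cutoffSection_apply (χ : C^∞⟮I, M; ℝ⟯) {U : Set M} (hU : IsOpen U)
    (hχ : tsupport χ ⊆ U) (s : ∀ x, V x) (hs : SmoothSectionOn I F s U) (x : M) :
    cutoffSection χ hU hχ s hs x = χ x • s x := rfl

theorem cutoffSection_mem (χ : C^∞⟮I, M; ℝ⟯) (hc : HasCompactSupport χ) {U : Set M}
    (hU : IsOpen U) (hχ : tsupport χ ⊆ U) (s : ∀ x, V x) (hs : SmoothSectionOn I F s U) :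
    cutoffSection χ hU hχ s hs ∈ compactSections I F V := by
  refine hc.of_isClosed_subset isClosed_closure (closure_mono fun x hx ↦ ?_)
  intro h0
  refine hx ?_
  rw [cutoffSection_apply, h0, zero_smul]

/-- Extension by zero of a function on an open set, after multiplication by a cut-off function. -/
noncomputable def cutoffFun (χ : C^∞⟮I, M; ℝ⟯) {U : Set M} (hU : IsOpen U) (hχ : tsupport χ ⊆ U)
    (f : M → ℝ) (hf : ContMDiffOn I 𝓘(ℝ, ℝ) ∞ f U) : C^∞⟮I, M; ℝ⟯ :=
  ⟨fun x ↦ χ x * f x, by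
    intro x
    by_cases hx : x ∈ tsupport χ
    · exact (χ.contMDiff x).mul ((hf x (hχ hx)).contMDiffAt (hU.mem_nhds (hχ hx)))
    · have : (fun x ↦ χ x * f x) =ᶠ[𝓝 x] fun _ ↦ 0 := by
        filter_upwards [notMem_tsupport_iff_eventuallyEq.1 hx] with y hy
        rw [hy]; simp
      exact contMDiffAt_const.congr_of_eventuallyEq this⟩

theorem cutoffFun_apply (χ : C^∞⟮I, M; ℝ⟯) {U : Set M} (hU : IsOpen U) (hχ : tsupport χ ⊆ U)
    (f : M → ℝ) (hf : ContMDiffOn I 𝓘(ℝ, ℝ) ∞ f U) (x : M) :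
    cutoffFun χ hU hχ f hf x = χ x * f x := rfl

variable (I) in
theorem exists_cutoff [IsManifold I ∞ M] [FiniteDimensional ℝ E] [T2Space M] (x : M) {U : Set M}
    (hU : U ∈ 𝓝 x) :
    ∃ χ : C^∞⟮I, M; ℝ⟯, tsupport χ ⊆ U ∧ HasCompactSupport χ ∧ ∀ᶠ y in 𝓝 x, χ y = 1 := by
  obtain ⟨f, -, hf⟩ := (SmoothBumpFunction.nhds_basis_tsupport (I := I) x).mem_iff.1 hU
  exact ⟨⟨f, f.contMDiff⟩, hf, f.hasCompactSupport, f.eventuallyEq_one⟩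

end GeneralBundle

variable [IsManifold I ∞ M]

/-! ### Vector fields and 1-forms -/

/-- The coordinates of tangent vectors in the preferred chart at `x₀`. -/
noncomputable abbrev tcoord (x₀ y : M) : TangentSpace I y →L[ℝ] E :=
  (trivializationAt E (TangentSpace I) x₀).continuousLinearMapAt ℝ y

/-- The tangent vector with given coordinates in the preferred chart at `x₀`. -/
noncomputable abbrev tcoordSymm (x₀ y : M) : E →L[ℝ] TangentSpace I y :=
  (trivializationAt E (TangentSpace I) x₀).symmL ℝ y

variable {I}

theorem tcoord_tcoordSymm {x₀ y : M} (hy : y ∈ (chartAt H x₀).source) (v : E) :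
    tcoord I x₀ y (tcoordSymm I x₀ y v) = v :=
  (trivializationAt E (TangentSpace I) x₀).continuousLinearMapAt_symmL hy v

theorem tcoordSymm_tcoord {x₀ y : M} (hy : y ∈ (chartAt H x₀).source) (v : TangentSpace I y) :
    tcoordSymm I x₀ y (tcoord I x₀ y v) = v :=
  (trivializationAt E (TangentSpace I) x₀).symmL_continuousLinearMapAt hy v

theorem contMDiffAt_vectorField_iff {X : ∀ x : M, TangentSpace I x} {x₀ x : M}
    (hx : x ∈ (chartAt H x₀).source) :
    ContMDiffAt I (I.prod 𝓘(ℝ, E)) ∞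
        (fun y ↦ (TotalSpace.mk' E y (X y) : TangentBundle I M)) x ↔
      ContMDiffAt I 𝓘(ℝ, E) ∞ (fun y ↦ tcoord I x₀ y (X y)) x := by
  rw [(trivializationAt E (TangentSpace I) x₀).contMDiffAt_section_iff hx]
  refine Filter.EventuallyEq.contMDiffAt_iff ?_
  filter_upwards [(chartAt H x₀).open_source.mem_nhds hx] with y hy
  exact (Trivialization.continuousLinearMapAt_apply_of_mem (R := ℝ)
    (trivializationAt E (TangentSpace I) x₀) hy (X y)).symm

theorem SmoothSectionOn.contMDiffOn_tcoord {X : ∀ x : M, TangentSpace I x} {U : Set M}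
    (hU : IsOpen U)
    (hX : SmoothSectionOn I E X U) (x₀ : M) :
    ContMDiffOn I 𝓘(ℝ, E) ∞ (fun y ↦ tcoord I x₀ y (X y)) (U ∩ (chartAt H x₀).source) :=
  fun x hx ↦ ((contMDiffAt_vectorField_iff hx.2).1
    ((hX x hx.1).contMDiffAt (hU.mem_nhds hx.1))).contMDiffWithinAt

theorem smoothSectionOn_of_tcoord {X : ∀ x : M, TangentSpace I x} {U : Set M}
    (hU : IsOpen U)
    {x₀ : M} (hUx : U ⊆ (chartAt H x₀).source)
    (hX : ContMDiffOn I 𝓘(ℝ, E) ∞ (fun y ↦ tcoord I x₀ y (X y)) U) :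
    SmoothSectionOn I E X U :=
  fun x hx ↦ ((contMDiffAt_vectorField_iff (hUx hx)).2
    ((hX x hx).contMDiffAt (hU.mem_nhds hx))).contMDiffWithinAt

theorem smoothSectionOn_tcoordSymm_const (x₀ : M) (v : E) :
    SmoothSectionOn I E (fun y ↦ tcoordSymm I x₀ y v) (chartAt H x₀).source := by
  refine smoothSectionOn_of_tcoord (chartAt H x₀).open_source subset_rfl ?_
  exact contMDiffOn_const.congr fun y hy ↦ tcoord_tcoordSymm hy v

/-- The 1-form with constant coefficients `ℓ` in the preferred chart at `x₀`. -/
noncomputable def constForm (x₀ : M) (ℓ : E →L[ℝ] ℝ) (y : M) : CotangentSpace I y :=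
  ℓ.comp (tcoord I x₀ y)

theorem constForm_apply (x₀ : M) (ℓ : E →L[ℝ] ℝ) (y : M) (v : TangentSpace I y) :
    constForm x₀ ℓ y v = ℓ (tcoord I x₀ y v) := rfl

theorem smoothSectionOn_constForm (x₀ : M) (ℓ : E →L[ℝ] ℝ) :
    SmoothSectionOn I (E →L[ℝ] ℝ) (V := fun x : M ↦ CotangentSpace I x)
      (constForm x₀ ℓ) (chartAt H x₀).source := by
  refine (Trivialization.contMDiffOn_section_iff
    (trivializationAt (E →L[ℝ] ℝ) (fun x : M ↦ CotangentSpace I x) x₀)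
    (chartAt H x₀).open_source ?_).2 ?_
  · intro y hy
    exact ⟨hy, mem_univ _⟩
  · refine contMDiffOn_const (c := ℓ) |>.congr fun y hy ↦ ?_
    ext v
    rw [hom_trivializationAt_apply]
    simp [ContinuousLinearMap.inCoordinates, constForm_apply]
    exact congrArg ℓ (tcoord_tcoordSymm (I := I) hy v)

theorem SmoothSectionOn.pairing {α : ∀ x : M, CotangentSpace I x} {X : ∀ x : M, TangentSpace I x}
    {U : Set M}
    (hα : SmoothSectionOn I (E →L[ℝ] ℝ) (V := fun x : M ↦ CotangentSpace I x) α U)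
    (hX : SmoothSectionOn I E X U) : ContMDiffOn I 𝓘(ℝ, ℝ) ∞ (fun x ↦ (α x (X x) : ℝ)) U := by
  intro x hx
  have := (ContMDiffOn.clm_bundle_apply (F₂ := ℝ) (E₂ := Bundle.Trivial M ℝ) hα hX) x hx
  rw [contMDiffWithinAt_section] at this
  exact this

section Sharp

variable [FiniteDimensional ℝ E] {π : ∀ x : M, ⋀[ℝ]^2 (TangentSpace I x)}

instance (x : M) : FiniteDimensional ℝ (TangentSpace I x) :=
  inferInstanceAs (FiniteDimensional ℝ E)

/-- Contraction of a smooth 1-form with a smooth bivector field is smooth. -/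
theorem SmoothSectionOn.sharp (hπ : SmoothMultivectorOn I 2 π univ)
    {α : ∀ x : M, CotangentSpace I x} {U : Set M} (hU : IsOpen U)
    (hα : SmoothSectionOn I (E →L[ℝ] ℝ) (V := fun x : M ↦ CotangentSpace I x) α U) :
    SmoothSectionOn I E (fun x ↦ bivectorSharp (π x) (α x : TangentSpace I x →ₗ[ℝ] ℝ)) U := by
  intro x₀ hx₀
  have hx₀' := mem_chart_source H x₀
  refine ContMDiffAt.contMDiffWithinAt ((contMDiffAt_vectorField_iff hx₀').2 ?_)
  let W := U ∩ (chartAt H x₀).source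
  have hW : IsOpen W := hU.inter (chartAt H x₀).open_source
  let b := Module.finBasis ℝ E
  let w (y : M) : ⋀[ℝ]^2 E := exteriorPower.map 2 (tcoord I x₀ y : TangentSpace I y →ₗ[ℝ] E) (π y)
  -- In the chart, `π♯α` is a sum of products of coefficients of `α` and of `π`, both smooth.
  have key : ∀ y ∈ W, tcoord I x₀ y (bivectorSharp (π y) (α y : TangentSpace I y →ₗ[ℝ] ℝ))
      = ∑ j, ∑ i, ((α y (tcoordSymm I x₀ y (b j)) : ℝ) *
          b.coord i (bivectorSharp (w y) (b.coord j))) • b i := by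
    intro y hy
    have h1 : (α y : TangentSpace I y →ₗ[ℝ] ℝ)
        = ((α y : TangentSpace I y →ₗ[ℝ] ℝ) ∘ₗ (tcoordSymm I x₀ y : E →ₗ[ℝ] TangentSpace I y)) ∘ₗ
          (tcoord I x₀ y : TangentSpace I y →ₗ[ℝ] E) := by
      ext v
      exact congrArg (α y) (tcoordSymm_tcoord hy.2 v).symm
    have h2 : ((α y : TangentSpace I y →ₗ[ℝ] ℝ) ∘ₗ
        (tcoordSymm I x₀ y : E →ₗ[ℝ] TangentSpace I y))
        = ∑ j, (α y (tcoordSymm I x₀ y (b j)) : ℝ) • b.coord j := by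
      refine b.ext fun i ↦ ?_
      simp [Finsupp.single_apply]
    have h3 : tcoord I x₀ y (bivectorSharp (π y) (α y : TangentSpace I y →ₗ[ℝ] ℝ))
        = bivectorSharp (w y) ((α y : TangentSpace I y →ₗ[ℝ] ℝ) ∘ₗ
          (tcoordSymm I x₀ y : E →ₗ[ℝ] TangentSpace I y)) := by
      rw [bivectorSharp_map, ← h1]; rfl
    rw [h3, h2, ← sharpHom_apply, map_sum]
    refine Finset.sum_congr rfl fun j _ ↦ ?_
    simp only [mul_smul, ← Finset.smul_sum, map_smul, sharpHom_apply]
    congr 1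
    exact (b.sum_repr _).symm
  have hs : ContMDiffOn I 𝓘(ℝ, E) ∞ (fun y ↦ ∑ j, ∑ i, ((α y (tcoordSymm I x₀ y (b j)) : ℝ) *
      b.coord i (bivectorSharp (w y) (b.coord j))) • b i) W := by
    refine contMDiffOn_finsetSum fun j _ ↦ contMDiffOn_finsetSum fun i _ ↦ ?_
    have h1 : ContMDiffOn I 𝓘(ℝ, ℝ) ∞ (fun y ↦ (α y (tcoordSymm I x₀ y (b j)) : ℝ)) W :=
      (hα.mono inter_subset_left).pairing
        ((smoothSectionOn_tcoordSymm_const x₀ (b j)).mono inter_subset_right)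
    have h2 : ContMDiffOn I 𝓘(ℝ, ℝ) ∞
        (fun y ↦ b.coord i (bivectorSharp (w y) (b.coord j))) W :=
      (hπ x₀ (b.coord i ∘ₗ sharpHom.flip (b.coord j))).mono fun y hy ↦ ⟨mem_univ _, hy.2⟩
    exact (h1.mul h2).smul contMDiffOn_const
  exact (hs.congr key).contMDiffAt (hW.mem_nhds ⟨hx₀, hx₀'⟩)

end Sharp

end SmoothSections

/-! ### Adapted frames of a bivector -/

section AdaptedAlgebra

open Module

variable {V : Type*} [AddCommGroup V] [Module ℝ V]

theorem wedgePow_map {W : Type*} [AddCommGroup W] [Module ℝ W] (f : V →ₗ[ℝ] W) (w : ⋀[ℝ]^2 V)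
    (k : ℕ) : wedgePow (exteriorPower.map 2 f w) k = exteriorPower.map (2 * k) f (wedgePow w k) := by
  have coe (p : ℕ) (x : ⋀[ℝ]^p V) : (exteriorPower.map p f x : ExteriorAlgebra ℝ W)
      = ExteriorAlgebra.map f (x : ExteriorAlgebra ℝ V) := by
    have : (Submodule.subtype _ ∘ₗ exteriorPower.map p f : ⋀[ℝ]^p V →ₗ[ℝ] ExteriorAlgebra ℝ W)
        = (ExteriorAlgebra.map f).toLinearMap ∘ₗ Submodule.subtype _ := by
      apply exteriorPower.linearMap_ext
      ext v
      simp [ExteriorAlgebra.map_apply_ιMulti]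
    exact LinearMap.congr_fun this x
  apply Subtype.ext
  rw [coe]
  simp only [wedgePow, coe, map_pow]

theorem eq_sum_of_mem_span_of_dual {r : ℕ} {Y : Fin r → V} {α : Fin r → Dual ℝ V}
    (h : ∀ l m, α l (Y m) = if l = m then 1 else 0) {v : V}
    (hv : v ∈ Submodule.span ℝ (Set.range Y)) : v = ∑ l, α l v • Y l := by
  induction hv using Submodule.span_induction with
  | mem x hx => obtain ⟨m, rfl⟩ := hx; simp [h]
  | zero => simp
  | add x y _ _ hx hy =>
    simp only [map_add, add_smul, Finset.sum_add_distrib]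
    rw [← hx, ← hy]
  | smul c x _ hx =>
    simp only [map_smul, smul_assoc, ← Finset.smul_sum]
    rw [← hx]

/-- This is the transpose of the hypothesis, since `w♯` is skew. -/
theorem bivectorSharp_eq_sum_of_adapted {w : ⋀[ℝ]^2 V} {r : ℕ} {Y : Fin r → V}
    {α : Fin r → Dual ℝ V}
    (h : ∀ β : Dual ℝ V, bivectorSharp w β = ∑ l, β (Y l) • bivectorSharp w (α l))
    (β : Dual ℝ V) : bivectorSharp w β = ∑ l, α l (bivectorSharp w β) • Y l := by
  rw [← sub_eq_zero, ← Module.forall_dual_apply_eq_zero_iff ℝ]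
  intro φ
  rw [map_sub, bivectorSharp_skew, h φ]
  simp only [map_sum, map_smul, smul_eq_mul]
  rw [← Finset.sum_neg_distrib, ← Finset.sum_sub_distrib]
  refine Finset.sum_eq_zero fun l _ ↦ ?_
  rw [bivectorSharp_skew w β (α l)]
  ring

theorem bivectorSharp_mem_span_of_adapted {w : ⋀[ℝ]^2 V} {r : ℕ} {Y : Fin r → V}
    {α : Fin r → Dual ℝ V}
    (h : ∀ β : Dual ℝ V, bivectorSharp w β = ∑ l, β (Y l) • bivectorSharp w (α l))
    (β : Dual ℝ V) : bivectorSharp w β ∈ Submodule.span ℝ (Set.range Y) := by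
  rw [bivectorSharp_eq_sum_of_adapted h β]
  exact Submodule.sum_mem _ fun l _ ↦ Submodule.smul_mem _ _ (Submodule.subset_span ⟨l, rfl⟩)

variable [FiniteDimensional ℝ V]

/-- The image lies in the span of `r` vectors and has dimension at least `r`. -/
theorem range_sharp_eq_span_of_adapted {w : ⋀[ℝ]^2 V} {r : ℕ} {Y : Fin r → V}
    {α : Fin r → Dual ℝ V}
    (h : ∀ β : Dual ℝ V, bivectorSharp w β = ∑ l, β (Y l) • bivectorSharp w (α l))
    (hr : r ≤ finrank ℝ (LinearMap.range (sharpHom w))) :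
    LinearMap.range (sharpHom w) = Submodule.span ℝ (Set.range Y) := by
  refine Submodule.eq_of_le_of_finrank_le ?_ (((finrank_range_le_card Y).trans ?_).trans hr)
  · rintro _ ⟨β, rfl⟩
    exact bivectorSharp_mem_span_of_adapted h β
  · simp

/-- At full rank each `Y l` is some `w♯γ`, and `β(w♯γ) = -γ(w♯β)`. -/
theorem apply_eq_zero_of_bivectorSharp_eq_zero {w : ⋀[ℝ]^2 V} {r : ℕ} {Y : Fin r → V}
    {α : Fin r → Dual ℝ V}
    (h : ∀ β : Dual ℝ V, bivectorSharp w β = ∑ l, β (Y l) • bivectorSharp w (α l))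
    (hr : r ≤ finrank ℝ (LinearMap.range (sharpHom w))) {β : Dual ℝ V}
    (hβ : bivectorSharp w β = 0) (l : Fin r) : β (Y l) = 0 := by
  have hY : Y l ∈ LinearMap.range (sharpHom w) := by
    rw [range_sharp_eq_span_of_adapted h hr]
    exact Submodule.subset_span ⟨l, rfl⟩
  obtain ⟨γ, hγ⟩ := hY
  rw [← hγ, sharpHom_apply, bivectorSharp_skew, hβ, map_zero, neg_zero]

theorem span_ιMulti_eq {p : ℕ} {Y Y' : Fin p → V}
    (h : ∀ m, Y' m ∈ Submodule.span ℝ (Set.range Y)) (h0 : exteriorPower.ιMulti ℝ p Y' ≠ 0) :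
    Submodule.span ℝ {exteriorPower.ιMulti ℝ p Y'}
      = Submodule.span ℝ {exteriorPower.ιMulti ℝ p Y} := by
  obtain ⟨c, hc⟩ := mem_span_ιMulti (σ := exteriorPower.ιMulti ℝ p Y') Y
    (ιMulti_mem_map_pow _ Y' h)
  have hc0 : c ≠ 0 := by
    rintro rfl
    exact h0 (by rw [hc, zero_smul])
  rw [hc, Submodule.span_singleton_smul_eq (IsUnit.mk0 c hc0)]

end AdaptedAlgebra

/-! ### Adapted frames and line subbundles. -/

section AdaptedFrames

open Bundle (TotalSpace Trivialization contMDiffAt_section contMDiffWithinAt_section)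
open Module Set Topology

variable {E : Type*} [NormedAddCommGroup E] [NormedSpace ℝ E] [FiniteDimensional ℝ E]
  {H : Type*} [TopologicalSpace H] {I : ModelWithCorners ℝ E H}
  {M : Type*} [TopologicalSpace M] [ChartedSpace H M] [IsManifold I ∞ M]

/-- Over the open set `U`, the image of contraction with `π` is contained in the span of the smooth
vector fields `Y l`, which have the smooth 1-forms `α l` as dual family. -/
structure IsAdaptedFrame (π : ∀ x : M, ⋀[ℝ]^2 (TangentSpace I x)) {r : ℕ} (U : Set M)
    (Y : Fin r → ∀ x : M, TangentSpace I x) (α : Fin r → ∀ x : M, CotangentSpace I x) : Prop where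
  isOpen : IsOpen U
  smooth_field : ∀ l, SmoothSectionOn I E (Y l) U
  smooth_form : ∀ l, SmoothSectionOn I (E →L[ℝ] ℝ) (V := fun x : M ↦ CotangentSpace I x) (α l) U
  dual : ∀ x ∈ U, ∀ l m, (α l x (Y m x) : ℝ) = if l = m then 1 else 0
  sharp_eq : ∀ x ∈ U, ∀ β : TangentSpace I x →ₗ[ℝ] ℝ, bivectorSharp (π x) β
    = ∑ l, β (Y l x) • bivectorSharp (π x) (α l x : TangentSpace I x →ₗ[ℝ] ℝ)

/-- The bivector field `π` has adapted frames with `r` elements near every point. -/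
def HasAdaptedFrames (π : ∀ x : M, ⋀[ℝ]^2 (TangentSpace I x)) (r : ℕ) : Prop :=
  ∀ x₀ : M, ∃ (U : Set M) (Y : Fin r → ∀ x : M, TangentSpace I x)
    (α : Fin r → ∀ x : M, CotangentSpace I x), x₀ ∈ U ∧ IsAdaptedFrame π U Y α

variable {π : ∀ x : M, ⋀[ℝ]^2 (TangentSpace I x)}

/-- Two adapted frames of generic rank span the same spaces. -/
theorem IsAdaptedFrame.eq_sum {k : ℕ} (hd : Dense {x : M | wedgePow (π x) k ≠ 0})
    {U U' : Set M} {Y Y' : Fin (2 * k) → ∀ x : M, TangentSpace I x}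
    {α α' : Fin (2 * k) → ∀ x : M, CotangentSpace I x} (h : IsAdaptedFrame π U Y α)
    (h' : IsAdaptedFrame π U' Y' α') {x : M} (hx : x ∈ U) (hx' : x ∈ U') (m : Fin (2 * k)) :
    Y' m x = ∑ l, (α l x (Y' m x) : ℝ) • Y l x := by
  rw [← sub_eq_zero]
  have hs : SmoothSectionOn I E (fun x ↦ Y' m x - ∑ l, (α l x (Y' m x) : ℝ) • Y l x) (U ∩ U') := by
    refine ((h'.smooth_field m).mono inter_subset_right).sub (.sum fun l _ ↦ .smul ?_ ?_)
    · exact ((h.smooth_form l).mono inter_subset_left).pairing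
        ((h'.smooth_field m).mono inter_subset_right)
    · exact (h.smooth_field l).mono inter_subset_left
  refine hs.eq_zero_of_dense (h.isOpen.inter h'.isOpen) hd ?_ x ⟨hx, hx'⟩
  rintro y ⟨hy, hy'⟩ hyr
  rw [sub_eq_zero]
  -- At a regular point both frames span the image of `π♯`.
  have hrk := two_mul_le_finrank_of_wedgePow_ne_zero hyr
  refine eq_sum_of_mem_span_of_dual (Y := fun l ↦ Y l y)
    (α := fun l ↦ (α l y : TangentSpace I y →ₗ[ℝ] ℝ)) (h.dual y hy) ?_
  rw [← range_sharp_eq_span_of_adapted (h.sharp_eq y hy) hrk,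
    range_sharp_eq_span_of_adapted (h'.sharp_eq y hy') hrk]
  exact Submodule.subset_span ⟨m, rfl⟩

theorem contMDiffOn_of_linearFunctionals {p : ℕ} {F : Type*} [NormedAddCommGroup F]
    [NormedSpace ℝ F] [FiniteDimensional ℝ F] {σ : ∀ x : M, ⋀[ℝ]^p (TangentSpace I x)} {U : Set M}
    (hσ : SmoothMultivectorOn I p σ U) (x₀ : M) (L : ⋀[ℝ]^p E →ₗ[ℝ] F) :
    ContMDiffOn I 𝓘(ℝ, F) ∞ (fun y ↦ L (exteriorPower.map p
      (tcoord I x₀ y : TangentSpace I y →ₗ[ℝ] E) (σ y))) (U ∩ (chartAt H x₀).source) := by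
  let b := Module.finBasis ℝ F
  have hs : ContMDiffOn I 𝓘(ℝ, F) ∞ (fun y ↦ ∑ i, (b.coord i (L (exteriorPower.map p
      (tcoord I x₀ y : TangentSpace I y →ₗ[ℝ] E) (σ y)))) • b i)
      (U ∩ (chartAt H x₀).source) := by
    refine contMDiffOn_finsetSum fun i _ ↦ ?_
    have := hσ x₀ (b.coord i ∘ₗ L)
    exact this.smul contMDiffOn_const
  exact hs.congr fun y _ ↦ (b.sum_repr _).symm

theorem tcoord_injective {x₀ y : M} (hy : y ∈ (chartAt H x₀).source) :
    Function.Injective (tcoord I x₀ y : TangentSpace I y →ₗ[ℝ] E) :=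
  Function.LeftInverse.injective fun v ↦ tcoordSymm_tcoord hy v

/-- A line subbundle through the top power of a bivector field which is generically nonzero
provides adapted frames. -/
theorem hasAdaptedFrames_of_lineSubbundle (hπ : SmoothMultivectorOn I 2 π univ) {k : ℕ}
    (hk : ∀ x : M, wedgePow (π x) (k + 1) = 0) (hd : Dense {x : M | wedgePow (π x) k ≠ 0})
    {K : ∀ x : M, Submodule ℝ (⋀[ℝ]^(2 * k) (TangentSpace I x))}
    (hK : IsLineSubbundle I (2 * k) K) (hmem : ∀ x : M, wedgePow (π x) k ∈ K x) :
    HasAdaptedFrames π (2 * k) := by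
  intro x₀
  obtain ⟨U, σ, hU, hx₀, hσ, hσK⟩ := hK x₀
  have hx₀' := mem_chart_source H x₀
  let s (y : M) : ⋀[ℝ]^(2 * k) E :=
    exteriorPower.map (2 * k) (tcoord I x₀ y : TangentSpace I y →ₗ[ℝ] E) (σ y)
  have hs0 : s x₀ ≠ 0 := by
    intro h0
    refine (hσK x₀ hx₀).1 (exteriorPower.map_injective_field (tcoord_injective hx₀') ?_)
    rw [map_zero]; exact h0
  obtain ⟨a, ha⟩ := exists_multiPair_ne_zero hs0
  let f (y : M) : ℝ := multiPair (s y) a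
  have hf : ContMDiffOn I 𝓘(ℝ, ℝ) ∞ f (U ∩ (chartAt H x₀).source) :=
    contMDiffOn_of_linearFunctionals hσ x₀
      (exteriorPower.pairingDual ℝ E (2 * k) (exteriorPower.ιMulti ℝ (2 * k) a))
  have hW₀ : IsOpen (U ∩ (chartAt H x₀).source) := hU.inter (chartAt H x₀).open_source
  -- On `W` the pairing `f` of the generator with `a` is invertible, so contraction with all
  -- covectors but the `l`-th can be normalised to a family dual to `a`.
  let W : Set M := (U ∩ (chartAt H x₀).source) ∩ f ⁻¹' {0}ᶜ
  have hW : IsOpen W := hf.continuousOn.isOpen_inter_preimage hW₀ isOpen_compl_singleton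
  have hWs : W ⊆ (chartAt H x₀).source := fun y hy ↦ hy.1.2
  let Y (l : Fin (2 * k)) (y : M) : TangentSpace I y :=
    tcoordSymm I x₀ y ((f y)⁻¹ • pairVector a l (s y))
  let α (l : Fin (2 * k)) (y : M) : CotangentSpace I y :=
    constForm x₀ (LinearMap.toContinuousLinearMap (a l)) y
  have hY : ∀ l, SmoothSectionOn I E (Y l) W := fun l ↦ by
    refine smoothSectionOn_of_tcoord hW hWs ?_
    have h1 : ContMDiffOn I 𝓘(ℝ, E) ∞ (fun y ↦ (f y)⁻¹ • pairVector a l (s y)) W :=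
      ((hf.mono inter_subset_left).inv₀ fun y hy ↦ hy.2).smul
        ((contMDiffOn_of_linearFunctionals hσ x₀ (pairVector a l)).mono inter_subset_left)
    exact h1.congr fun y hy ↦ tcoord_tcoordSymm (hWs hy) _
  have hα : ∀ l, SmoothSectionOn I (E →L[ℝ] ℝ) (V := fun x : M ↦ CotangentSpace I x) (α l) W :=
    fun l ↦ (smoothSectionOn_constForm x₀ _).mono hWs
  have hreg : ∀ y ∈ W, wedgePow (π y) k ≠ 0 → ∀ ℓ : E →ₗ[ℝ] ℝ,
      bivectorSharp (π y) (ℓ ∘ₗ (tcoord I x₀ y : TangentSpace I y →ₗ[ℝ] E))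
        = ∑ l, ℓ ((f y)⁻¹ • pairVector a l (s y)) •
          bivectorSharp (π y) (a l ∘ₗ (tcoord I x₀ y : TangentSpace I y →ₗ[ℝ] E)) := by
    intro y hy hyr ℓ
    let T : TangentSpace I y →ₗ[ℝ] E := (tcoord I x₀ y : TangentSpace I y →ₗ[ℝ] E)
    have hT := tcoord_injective (I := I) (hWs hy)
    have hmem' := hmem y
    rw [(hσK y hy.1.1).2, Submodule.mem_span_singleton] at hmem'
    obtain ⟨c, hc⟩ := hmem'
    have hc0 : c ≠ 0 := by
      rintro rfl
      exact hyr (by rw [← hc, zero_smul])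
    have h1 : wedgePow (exteriorPower.map 2 T (π y)) k = c • s y := by
      rw [wedgePow_map, ← hc, map_smul]
    have h2 : wedgePow (exteriorPower.map 2 T (π y)) k ≠ 0 := by
      rw [wedgePow_map]
      intro h0
      refine hyr (exteriorPower.map_injective_field hT ?_)
      rw [map_zero]; exact h0
    have h3 : wedgePow (exteriorPower.map 2 T (π y)) (k + 1) = 0 := by
      rw [wedgePow_map, hk, map_zero]
    have h4 := smul_bivectorSharp_eq_sum h2 h3 a ℓ
    simp only [h1, multiPair_smul, mul_smul, ← Finset.smul_sum] at h4
    -- Cancelling the factor `c` between `∧^kπ` and the generator leaves an identity whose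
    -- coefficients stay smooth across the singular points.
    have h5 := smul_right_injective E hc0 h4
    simp only [bivectorSharp_map, ← map_smul, ← map_sum] at h5
    have h6 := hT h5
    have hf0 : f y ≠ 0 := hy.2
    change f y • _ = _ at h6
    calc _ = (f y)⁻¹ • (f y • bivectorSharp (π y) (ℓ ∘ₗ T)) := by
          rw [smul_smul, inv_mul_cancel₀ hf0, one_smul]
      _ = _ := by
          rw [h6, Finset.smul_sum]
          refine Finset.sum_congr rfl fun l _ ↦ ?_
          rw [smul_smul, map_smul, apply_pairVector, smul_eq_mul]
  refine ⟨W, Y, α, ⟨⟨hx₀, hx₀'⟩, ha⟩, hW, hY, hα, ?_, ?_⟩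
  · intro y hy l m
    change a l (tcoord I x₀ y (tcoordSymm I x₀ y _)) = _
    rw [tcoord_tcoordSymm (hWs hy), map_smul, apply_pairVector, multiPair_update_self]
    split_ifs
    · exact inv_mul_cancel₀ hy.2
    · exact mul_zero _
  · intro x hx β
    let ℓ : E →ₗ[ℝ] ℝ := β ∘ₗ (tcoordSymm I x₀ x : E →ₗ[ℝ] TangentSpace I x)
    have hβ : β = ℓ ∘ₗ (tcoord I x₀ x : TangentSpace I x →ₗ[ℝ] E) := by
      ext v
      exact congrArg β (tcoordSymm_tcoord (hWs hx) v).symm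
    -- The covector at `x` is extended to a form with constant coefficients in the chart, so that
    -- the identity becomes the vanishing of a smooth vector field.
    let B (y : M) : CotangentSpace I y := constForm x₀ (LinearMap.toContinuousLinearMap ℓ) y
    have hB : SmoothSectionOn I (E →L[ℝ] ℝ) (V := fun x : M ↦ CotangentSpace I x) B W :=
      (smoothSectionOn_constForm x₀ _).mono hWs
    have hZ : SmoothSectionOn I E (fun y ↦ bivectorSharp (π y) (B y : TangentSpace I y →ₗ[ℝ] ℝ)
        - ∑ l, (B y (Y l y) : ℝ) • bivectorSharp (π y) (α l y : TangentSpace I y →ₗ[ℝ] ℝ)) W :=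
      (hB.sharp hπ hW).sub (.sum fun l _ ↦ .smul (hB.pairing (hY l)) ((hα l).sharp hπ hW))
    have h0 := hZ.eq_zero_of_dense hW hd (fun y hy hyr ↦ by
      rw [sub_eq_zero]
      refine (hreg y hy hyr ℓ).trans (Finset.sum_congr rfl fun l _ ↦ ?_)
      congr 1
      exact congrArg ℓ (tcoord_tcoordSymm (hWs hy) _).symm) x hx
    rw [sub_eq_zero] at h0
    rw [hβ]
    exact h0

theorem smoothMultivectorOn_ιMulti {p : ℕ} {U : Set M} (hU : IsOpen U)
    {Y : Fin p → ∀ x : M, TangentSpace I x} (hY : ∀ l, SmoothSectionOn I E (Y l) U) :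
    SmoothMultivectorOn I p (fun x ↦ exteriorPower.ιMulti ℝ p fun l ↦ Y l x) U := by
  intro x₀ ℓ
  let A : E [⋀^Fin p]→ₗ[ℝ] ℝ := exteriorPower.alternatingMapLinearEquiv.symm ℓ
  let b := Module.finBasis ℝ E
  have key : ∀ v : Fin p → E, ℓ (exteriorPower.ιMulti ℝ p v)
      = ∑ j : Fin p → Fin (finrank ℝ E), (∏ l, b.coord (j l) (v l)) * A fun l ↦ b (j l) := by
    intro v
    have h1 : v = fun l ↦ ∑ i, b.coord i (v l) • b i := by
      ext1 l
      exact (b.sum_repr (v l)).symm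
    have h2 : ℓ (exteriorPower.ιMulti ℝ p v) = A.toMultilinearMap v := rfl
    rw [h2]
    conv_lhs => rw [h1]
    rw [MultilinearMap.map_sum]
    refine Finset.sum_congr rfl fun j _ ↦ ?_
    rw [MultilinearMap.map_smul_univ]
    rfl
  have hs : ContMDiffOn I 𝓘(ℝ, ℝ) ∞ (fun y ↦ ∑ j : Fin p → Fin (finrank ℝ E),
      (∏ l, b.coord (j l) (tcoord I x₀ y (Y l y))) * A fun l ↦ b (j l))
      (U ∩ (chartAt H x₀).source) := by
    refine contMDiffOn_finsetSum fun j _ ↦ ?_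
    refine ContMDiffOn.mul (contMDiffOn_finsetProd fun l _ ↦ ?_) contMDiffOn_const
    exact (LinearMap.toContinuousLinearMap (b.coord (j l))).contMDiff.comp_contMDiffOn
      ((hY l).contMDiffOn_tcoord hU x₀)
  refine hs.congr fun y _ ↦ ?_
  rw [exteriorPower.map_apply_ιMulti]
  exact key _

/-- Adapted frames of generic rank provide a line subbundle through the top power. -/
theorem exists_lineSubbundle_of_hasAdaptedFrames {k : ℕ}
    (hd : Dense {x : M | wedgePow (π x) k ≠ 0}) (h : HasAdaptedFrames π (2 * k)) :
    ∃ K : ∀ x : M, Submodule ℝ (⋀[ℝ]^(2 * k) (TangentSpace I x)),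
      IsLineSubbundle I (2 * k) K ∧ ∀ x : M, wedgePow (π x) k ∈ K x := by
  choose U Y α hx hF using h
  have hne (x₀ x : M) (hxU : x ∈ U x₀) :
      exteriorPower.ιMulti ℝ (2 * k) (fun l ↦ Y x₀ l x) ≠ 0 :=
    ιMulti_ne_zero_of_dual (α := fun l ↦ (α x₀ l x : TangentSpace I x →ₗ[ℝ] ℝ))
      ((hF x₀).dual x hxU)
  refine ⟨fun x ↦ Submodule.span ℝ {exteriorPower.ιMulti ℝ (2 * k) fun l ↦ Y x l x},
    fun x₀ ↦ ⟨U x₀, fun x ↦ exteriorPower.ιMulti ℝ (2 * k) fun l ↦ Y x₀ l x, (hF x₀).isOpen, hx x₀,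
      smoothMultivectorOn_ιMulti (hF x₀).isOpen (hF x₀).smooth_field,
      fun x hxU ↦ ⟨hne x₀ x hxU, ?_⟩⟩, fun x ↦ ?_⟩
  -- The line at `x` is defined by the frame chosen at `x`; near `x₀` it is also spanned by the
  -- smooth frame chosen at `x₀`.
  · refine span_ιMulti_eq (fun m ↦ ?_) (hne x x (hx x))
    rw [IsAdaptedFrame.eq_sum hd (hF x₀) (hF x) hxU (hx x) m]
    exact Submodule.sum_mem _ fun l _ ↦ Submodule.smul_mem _ _ (Submodule.subset_span ⟨l, rfl⟩)
  · obtain ⟨c, hc⟩ := wedgePow_eq_smul_ιMulti (w := π x) (fun l ↦ Y x l x)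
      (bivectorSharp_mem_span_of_adapted ((hF x).sharp_eq x (hx x)))
    rw [hc]
    exact Submodule.smul_mem _ _ (Submodule.mem_span_singleton_self _)

end AdaptedFrames

/-! ### From adapted frames to a vector bundle -/

section FrameBundle

open Bundle (TotalSpace Trivialization contMDiffAt_section contMDiffWithinAt_section)
open Module Set Topology

variable {E : Type*} [NormedAddCommGroup E] [NormedSpace ℝ E] [FiniteDimensional ℝ E]
  {H : Type*} [TopologicalSpace H] {I : ModelWithCorners ℝ E H}
  {M : Type*} [TopologicalSpace M] [ChartedSpace H M] [IsManifold I ∞ M]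

/-- The linear map of matrix `α l (Y m)` at a point, from coordinates in the first frame to
coordinates in the second frame. -/
noncomputable def frameChange {p : ℕ} (α : Fin p → ∀ x : M, CotangentSpace I x)
    (Y : Fin p → ∀ x : M, TangentSpace I x) (x : M) :
    EuclideanSpace ℝ (Fin p) →L[ℝ] EuclideanSpace ℝ (Fin p) :=
  ∑ l, ∑ m, (α l x (Y m x) : ℝ) •
    (EuclideanSpace.proj l : EuclideanSpace ℝ (Fin p) →L[ℝ] ℝ).smulRight
      (EuclideanSpace.single m (1 : ℝ))

omit [FiniteDimensional ℝ E] [IsManifold I ∞ M] in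
theorem frameChange_apply {p : ℕ} (α : Fin p → ∀ x : M, CotangentSpace I x)
    (Y : Fin p → ∀ x : M, TangentSpace I x) (x : M) (v : EuclideanSpace ℝ (Fin p)) (m : Fin p) :
    frameChange α Y x v m = ∑ l, v l * (α l x (Y m x) : ℝ) := by
  simp [frameChange, Pi.single_apply, mul_comm]

theorem contMDiffOn_frameChange {p : ℕ} {α : Fin p → ∀ x : M, CotangentSpace I x}
    {Y : Fin p → ∀ x : M, TangentSpace I x} {U : Set M}
    (hα : ∀ l, SmoothSectionOn I (E →L[ℝ] ℝ) (V := fun x : M ↦ CotangentSpace I x) (α l) U)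
    (hY : ∀ m, SmoothSectionOn I E (Y m) U) :
    ContMDiffOn I 𝓘(ℝ, EuclideanSpace ℝ (Fin p) →L[ℝ] EuclideanSpace ℝ (Fin p)) ∞
      (frameChange α Y) U := by
  unfold frameChange
  exact contMDiffOn_finsetSum fun l _ ↦ contMDiffOn_finsetSum fun m _ ↦
    ((hα l).pairing (hY m)).smul contMDiffOn_const

variable {π : ∀ x : M, ⋀[ℝ]^2 (TangentSpace I x)} {k : ℕ}
  {U : M → Set M} {Y : M → Fin (2 * k) → ∀ x : M, TangentSpace I x}
  {α : M → Fin (2 * k) → ∀ x : M, CotangentSpace I x}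

/-- The vector bundle whose sections are the coordinates of contractions in adapted frames. -/
noncomputable def frameCore (hd : Dense {x : M | wedgePow (π x) k ≠ 0}) (hx : ∀ x, x ∈ U x)
    (hF : ∀ x, IsAdaptedFrame π (U x) (Y x) (α x)) :
    VectorBundleCore ℝ M (EuclideanSpace ℝ (Fin (2 * k))) M where
  baseSet := U
  isOpen_baseSet i := (hF i).isOpen
  indexAt := id
  mem_baseSet_at := hx
  coordChange i j x := frameChange (α i) (Y j) x
  coordChange_self i x hxi v := by
    ext m
    simp [frameChange_apply, (hF i).dual x hxi]
  continuousOn_coordChange i j :=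
    (contMDiffOn_frameChange (fun l ↦ ((hF i).smooth_form l).mono inter_subset_left)
      (fun m ↦ ((hF j).smooth_field m).mono inter_subset_right)).continuousOn
  coordChange_comp i j l x hxi v := by
    ext m
    simp only [frameChange_apply]
    -- The cocycle identity is the expansion of the third frame in the second, paired with the forms
    -- of the first.
    have h := (hF j).eq_sum hd (hF l) hxi.1.2 hxi.2 m
    calc _ = ∑ b, v b * ∑ a, (α i b x (Y j a x) : ℝ) * (α j a x (Y l m x) : ℝ) := by
          simp only [Finset.sum_mul, Finset.mul_sum]
          rw [Finset.sum_comm]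
          simp only [mul_assoc]
      _ = _ := by
          refine Finset.sum_congr rfl fun b _ ↦ ?_
          congr 1
          conv_rhs => rw [h, map_sum]
          refine Finset.sum_congr rfl fun a _ ↦ ?_
          rw [map_smul, smul_eq_mul, mul_comm]

instance frameCore_isContMDiff (hd : Dense {x : M | wedgePow (π x) k ≠ 0}) (hx : ∀ x, x ∈ U x)
    (hF : ∀ x, IsAdaptedFrame π (U x) (Y x) (α x)) : (frameCore hd hx hF).IsContMDiff I ∞ where
  contMDiffOn_coordChange i j :=
    contMDiffOn_frameChange (fun l ↦ ((hF i).smooth_form l).mono inter_subset_left)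
      (fun m ↦ ((hF j).smooth_field m).mono inter_subset_right)

/-- The smooth vector bundle defined by adapted frames. -/
noncomputable def frameBundle (hd : Dense {x : M | wedgePow (π x) k ≠ 0}) (hx : ∀ x, x ∈ U x)
    (hF : ∀ x, IsAdaptedFrame π (U x) (Y x) (α x)) : SmoothVectorBundleOver I M where
  rank := 2 * k
  Fiber := (frameCore hd hx hF).Fiber

/-- The coordinates of a covector in the adapted frame attached to its base point. -/
noncomputable def frameCoords (Y : M → Fin (2 * k) → ∀ x : M, TangentSpace I x) (x : M)
    (β : CotangentSpace I x) : EuclideanSpace ℝ (Fin (2 * k)) :=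
  WithLp.toLp 2 fun l ↦ (β (Y x l x) : ℝ)

theorem frameChange_frameCoords (hd : Dense {x : M | wedgePow (π x) k ≠ 0}) (hx : ∀ x, x ∈ U x)
    (hF : ∀ x, IsAdaptedFrame π (U x) (Y x) (α x)) {x₀ x : M} (hxU : x ∈ U x₀)
    (β : CotangentSpace I x) (m : Fin (2 * k)) :
    frameChange (α x) (Y x₀) x (frameCoords Y x β) m = (β (Y x₀ m x) : ℝ) := by
  rw [frameChange_apply]
  conv_rhs => rw [(hF x).eq_sum hd (hF x₀) (hx x) hxU m, map_sum]
  refine Finset.sum_congr rfl fun l _ ↦ ?_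
  rw [map_smul, smul_eq_mul]
  exact mul_comm _ _

/-- The frame changes with the base point, but in the trivialization at `x₀` the coordinates become
the smooth functions `β(Y x₀ m)`. -/
theorem smooth_frameCoords (hd : Dense {x : M | wedgePow (π x) k ≠ 0}) (hx : ∀ x, x ∈ U x)
    (hF : ∀ x, IsAdaptedFrame π (U x) (Y x) (α x))
    (β : Cₛ^∞⟮I; E →L[ℝ] ℝ, fun x : M ↦ CotangentSpace I x⟯) :
    ContMDiff I (I.prod 𝓘(ℝ, EuclideanSpace ℝ (Fin (2 * k)))) ∞ (fun x ↦
      (TotalSpace.mk' (EuclideanSpace ℝ (Fin (2 * k))) x (frameCoords Y x (β x)) :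
        TotalSpace (EuclideanSpace ℝ (Fin (2 * k))) (frameCore hd hx hF).Fiber)) := by
  intro x₀
  refine (contMDiffAt_section (E := (frameCore hd hx hF).Fiber)
    (s := fun x ↦ frameCoords Y x (β x)) x₀).2 ?_
  have h1 : ContMDiffOn I 𝓘(ℝ, EuclideanSpace ℝ (Fin (2 * k))) ∞
      (fun x ↦ ∑ m, (β x (Y x₀ m x) : ℝ) • EuclideanSpace.single m (1 : ℝ)) (U x₀) :=
    contMDiffOn_finsetSum fun m _ ↦
      (SmoothSectionOn.pairing β.contMDiff.contMDiffOn ((hF x₀).smooth_field m)).smul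
        contMDiffOn_const
  refine (h1.contMDiffAt ((hF x₀).isOpen.mem_nhds (hx x₀))).congr_of_eventuallyEq ?_
  filter_upwards [(hF x₀).isOpen.mem_nhds (hx x₀)] with x hxU
  change frameChange (α x) (Y x₀) x (frameCoords Y x (β x)) = _
  ext m
  rw [frameChange_frameCoords hd hx hF hxU]
  simp [Pi.single_apply]

/-- Coordinates in adapted frames, as a map of modules. -/
noncomputable def frameCoordsHom (hd : Dense {x : M | wedgePow (π x) k ≠ 0}) (hx : ∀ x, x ∈ U x)
    (hF : ∀ x, IsAdaptedFrame π (U x) (Y x) (α x)) :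
    compactSections I (E →L[ℝ] ℝ) (fun x : M ↦ CotangentSpace I x) →ₗ[C^∞⟮I, M; ℝ⟯]
      compactSections I (EuclideanSpace ℝ (Fin (frameBundle hd hx hF).rank))
        (frameBundle hd hx hF).Fiber where
  toFun β := ⟨⟨fun x ↦ frameCoords Y x (β.1 x), smooth_frameCoords hd hx hF β.1⟩, by
    refine β.2.of_isClosed_subset isClosed_closure (closure_mono fun x hxn h0 ↦ hxn ?_)
    change frameCoords Y x (β.1 x) = 0
    rw [h0]
    ext l
    rfl⟩
  map_add' β γ := by
    apply Subtype.ext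
    apply ContMDiffSection.ext
    intro x
    change frameCoords Y x (β.1 x + γ.1 x) = frameCoords Y x (β.1 x) + frameCoords Y x (γ.1 x)
    ext l
    rfl
  map_smul' f β := by
    apply Subtype.ext
    apply ContMDiffSection.ext
    intro x
    change frameCoords Y x (f x • β.1 x) = f x • frameCoords Y x (β.1 x)
    ext l
    rfl

/-- Contraction with a bivector field, as a map of modules onto the singular foliation. -/
noncomputable def sharpModuleHom (hπ : SmoothMultivectorOn I 2 π univ) :
    compactSections I (E →L[ℝ] ℝ) (fun x : M ↦ CotangentSpace I x) →ₗ[C^∞⟮I, M; ℝ⟯]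
      poissonFoliation I π where
  toFun β := ⟨⟨fun x ↦ bivectorSharp (π x) (β.1 x : TangentSpace I x →ₗ[ℝ] ℝ),
    contMDiffOn_univ.1 (SmoothSectionOn.sharp hπ isOpen_univ β.1.contMDiff.contMDiffOn)⟩,
    β.1, β.2, fun _ ↦ rfl⟩
  map_add' β γ := by
    apply Subtype.ext
    apply ContMDiffSection.ext
    intro x
    exact (sharpHom (π x)).map_add _ _
  map_smul' f β := by
    apply Subtype.ext
    apply ContMDiffSection.ext
    intro x
    exact (sharpHom (π x)).map_smul (f x) _

theorem sharpModuleHom_apply (hπ : SmoothMultivectorOn I 2 π univ)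
    (β : compactSections I (E →L[ℝ] ℝ) (fun x : M ↦ CotangentSpace I x)) (x : M) :
    (sharpModuleHom hπ β).1 x = bivectorSharp (π x) (β.1 x : TangentSpace I x →ₗ[ℝ] ℝ) := rfl

theorem sharpModuleHom_surjective (hπ : SmoothMultivectorOn I 2 π univ) :
    Function.Surjective (sharpModuleHom hπ) := by
  rintro ⟨X, β, hβ, hX⟩
  exact ⟨⟨β, hβ⟩, Subtype.ext (ContMDiffSection.ext fun x ↦ (hX x).symm)⟩

theorem ker_frameCoordsHom (hπ : SmoothMultivectorOn I 2 π univ)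
    (hd : Dense {x : M | wedgePow (π x) k ≠ 0}) (hx : ∀ x, x ∈ U x)
    (hF : ∀ x, IsAdaptedFrame π (U x) (Y x) (α x)) :
    LinearMap.ker (sharpModuleHom hπ) = LinearMap.ker (frameCoordsHom hd hx hF) := by
  ext β
  rw [LinearMap.mem_ker, LinearMap.mem_ker]
  constructor
  · intro h
    have h0 (x : M) : bivectorSharp (π x) (β.1 x : TangentSpace I x →ₗ[ℝ] ℝ) = 0 :=
      congrArg (fun Z ↦ Z.1 x) h
    apply Subtype.ext
    apply ContMDiffSection.ext
    intro x
    change frameCoords Y x (β.1 x) = 0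
    ext l
    -- The functions `β(Y l)` vanish at regular points, hence everywhere by continuity.
    refine ContMDiffOn.eq_zero_of_dense (hF x).isOpen hd
      (SmoothSectionOn.pairing β.1.contMDiff.contMDiffOn ((hF x).smooth_field l)) ?_ x (hx x)
    intro y hy hyr
    exact apply_eq_zero_of_bivectorSharp_eq_zero ((hF x).sharp_eq y hy)
      (two_mul_le_finrank_of_wedgePow_ne_zero hyr) (h0 y) l
  · intro h
    have h0 (x : M) : frameCoords Y x (β.1 x) = 0 := congrArg (fun Z ↦ Z.1 x) h
    apply Subtype.ext
    apply ContMDiffSection.ext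
    intro x
    rw [sharpModuleHom_apply, (hF x).sharp_eq x (hx x)]
    refine Finset.sum_eq_zero fun l _ ↦ ?_
    have h1 : (β.1 x (Y x l x) : ℝ) = 0 := congrArg (fun v ↦ v.ofLp l) (h0 x)
    exact (congrArg (· • _) h1).trans (zero_smul _ _)

/-- Locally `∑ t_m α m` has coordinates `t`, by duality. The forms with given coordinates make up an
affine, hence convex, set, so a partition of unity glues local solutions. -/
theorem frameCoordsHom_surjective [T2Space M] [SigmaCompactSpace M]
    (hd : Dense {x : M | wedgePow (π x) k ≠ 0}) (hx : ∀ x, x ∈ U x)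
    (hF : ∀ x, IsAdaptedFrame π (U x) (Y x) (α x)) :
    Function.Surjective (frameCoordsHom hd hx hF) := by
  rintro ⟨t, ht⟩
  let τ (x : M) : EuclideanSpace ℝ (Fin (2 * k)) := t x
  let S : Set M := closure {x | t x ≠ 0}
  have hS : ∀ x, x ∉ S → τ x = 0 := fun x hxS ↦ by
    by_contra h
    exact hxS (subset_closure h)
  -- The second condition keeps the glued form supported in the support of `t`, hence compactly
  -- supported.
  let C (x : M) : Set (CotangentSpace I x) :=
    {β | frameCoords Y x β = τ x ∧ (x ∉ S → β = 0)}
  have key : ∃ β : Cₛ^∞⟮I; E →L[ℝ] ℝ, fun x : M ↦ CotangentSpace I x⟯, ∀ x, β x ∈ C x := by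
    refine exists_contMDiffSection_forall_mem_convex_of_local (I := I) (n := ⊤)
      (F_fiber := E →L[ℝ] ℝ) (fun x : M ↦ CotangentSpace I x) C ?_ ?_
    · rintro x β ⟨hβ, hβ'⟩ γ ⟨hγ, hγ'⟩ a b ha hb hab
      constructor
      · have : frameCoords Y x (a • β + b • γ) = a • frameCoords Y x β + b • frameCoords Y x γ := by
          ext l; rfl
        rw [this, hβ, hγ, ← add_smul, hab, one_smul]
      · intro hxS
        rw [hβ' hxS, hγ' hxS, smul_zero, smul_zero, add_zero]
    · intro x₀
      by_cases hxS : x₀ ∈ S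
      · let Z := frameCore hd hx hF
        have hc : ContMDiffOn I 𝓘(ℝ, EuclideanSpace ℝ (Fin (2 * k))) ∞
            (fun y ↦ frameChange (α y) (Y x₀) y (τ y)) (U x₀) := by
          have h1 := ((trivializationAt (EuclideanSpace ℝ (Fin (2 * k))) Z.Fiber
            x₀).contMDiffOn_section_baseSet_iff (IB := I) (n := ∞)).1 t.contMDiff.contMDiffOn
          exact h1
        refine ⟨U x₀, (hF x₀).isOpen.mem_nhds (hx x₀),
          fun y ↦ ∑ m, frameChange (α y) (Y x₀) y (τ y) m • α x₀ m y, ?_, ?_⟩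
        · refine SmoothSectionOn.sum fun m _ ↦ SmoothSectionOn.smul ?_ ((hF x₀).smooth_form m)
          exact (EuclideanSpace.proj m : EuclideanSpace ℝ (Fin (2 * k)) →L[ℝ] ℝ).contMDiff.comp_contMDiffOn
            hc
        · intro y hy
          constructor
          · have h1 := Z.coordChange_comp y x₀ y y ⟨⟨hx y, hy⟩, hx y⟩ (τ y)
            rw [Z.coordChange_self y y (hx y)] at h1
            rw [← h1]
            ext l
            change _ = frameChange (α x₀) (Y y) y (frameChange (α y) (Y x₀) y (τ y)) l
            rw [frameChange_apply]
            simp [frameCoords]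
          · intro hyS
            simp [hS y hyS]
      · refine ⟨Sᶜ, isClosed_closure.isOpen_compl.mem_nhds hxS, fun y ↦ 0,
          (Bundle.contMDiff_zeroSection ℝ _).contMDiffOn, fun y hy ↦ ⟨?_, fun _ ↦ rfl⟩⟩
        rw [hS y hy]
        ext l
        rfl
  obtain ⟨β, hβ⟩ := key
  refine ⟨⟨β, ?_⟩, ?_⟩
  · refine ht.of_isClosed_subset isClosed_closure ?_
    refine closure_minimal (fun x hxn ↦ ?_) isClosed_closure
    by_contra h
    exact hxn ((hβ x).2 h)
  · apply Subtype.ext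
    apply ContMDiffSection.ext
    intro x
    exact (hβ x).1

theorem isAlmostRegular_of_hasAdaptedFrames [T2Space M] [SigmaCompactSpace M]
    (hπ : SmoothMultivectorOn I 2 π univ) (hd : Dense {x : M | wedgePow (π x) k ≠ 0})
    (h : HasAdaptedFrames π (2 * k)) : IsAlmostRegular I π := by
  choose U Y α hx hF using h
  exact ⟨frameBundle hd hx hF,
    ⟨((sharpModuleHom hπ).quotKerEquivOfSurjective (sharpModuleHom_surjective hπ)).symm ≪≫ₗ
      Submodule.quotEquivOfEq _ _ (ker_frameCoordsHom hπ hd hx hF) ≪≫ₗ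
      (frameCoordsHom hd hx hF).quotKerEquivOfSurjective (frameCoordsHom_surjective hd hx hF)⟩⟩

end FrameBundle

/-! ### Pointwise dependent families of smooth maps -/

section Relations

open Module Set Topology

variable {E : Type*} [NormedAddCommGroup E] [NormedSpace ℝ E] [FiniteDimensional ℝ E]
  {H : Type*} [TopologicalSpace H] {I : ModelWithCorners ℝ E H}
  {M : Type*} [TopologicalSpace M] [ChartedSpace H M]
  {F : Type*} [NormedAddCommGroup F] [NormedSpace ℝ F] [FiniteDimensional ℝ F]

theorem contMDiffOn_det {r : ℕ} {A : M → Matrix (Fin r) (Fin r) ℝ} {U : Set M}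
    (hA : ∀ i j, ContMDiffOn I 𝓘(ℝ, ℝ) ∞ (fun y ↦ A y i j) U) :
    ContMDiffOn I 𝓘(ℝ, ℝ) ∞ (fun y ↦ (A y).det) U := by
  simp only [Matrix.det_apply']
  exact contMDiffOn_finsetSum fun σ _ ↦
    contMDiffOn_const.mul (contMDiffOn_finsetProd fun i _ ↦ hA _ _)

/-- Smooth maps to a vector space which are everywhere linearly dependent satisfy, over some open
subset, a linear relation with smooth coefficients which are not all zero. -/
theorem exists_smooth_relation {r : ℕ} {x : Fin r → M → F} {W : Set M} (hW : IsOpen W)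
    (hne : W.Nonempty) (hx : ∀ i, ContMDiffOn I 𝓘(ℝ, F) ∞ (x i) W)
    (hdep : ∀ y ∈ W, ¬ LinearIndependent ℝ fun i ↦ x i y) :
    ∃ W' ⊆ W, IsOpen W' ∧ ∃ c : Fin r → M → ℝ, (∀ i, ContMDiffOn I 𝓘(ℝ, ℝ) ∞ (c i) W') ∧
      (∀ y ∈ W', ∑ i, c i y • x i y = 0) ∧ ∃ y ∈ W', ∃ i, c i y ≠ 0 := by
  induction r generalizing W with
  | zero =>
    obtain ⟨y, hy⟩ := hne
    exact absurd linearIndependent_empty_type (hdep y hy)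
  | succ r ih =>
    -- If the first `r` maps are dependent throughout `W`, induction applies. Otherwise they are
    -- independent at some `y`, hence near `y`, and Cramer's rule expresses the last map through
    -- them, with the determinant as its coefficient.
    by_cases hinit : ∀ y ∈ W, ¬ LinearIndependent ℝ fun i : Fin r ↦ x i.castSucc y
    · obtain ⟨W', hW'W, hW', c, hc, hrel, y, hy, i, hi⟩ :=
        ih (x := fun i ↦ x i.castSucc) hW hne (fun i ↦ hx _) hinit
      refine ⟨W', hW'W, hW', Fin.snoc (α := fun _ ↦ M → ℝ) c fun _ ↦ 0, fun j ↦ ?_, fun z hz ↦ ?_,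
        y, hy, i.castSucc, by simpa using hi⟩
      · refine Fin.lastCases ?_ (fun j ↦ ?_) j
        · simpa using contMDiffOn_const
        · simpa using hc j
      · rw [Fin.sum_univ_castSucc]
        simpa using hrel z hz
    · push Not at hinit
      obtain ⟨y, hy, hind⟩ := hinit
      obtain ⟨φ, hφ⟩ := exists_dual_of_linearIndependent hind
      let L (z : M) : Matrix (Fin r) (Fin r) ℝ := .of fun a b ↦ φ a (x b.castSucc z)
      let g (z : M) (a : Fin r) : ℝ := φ a (x (Fin.last r) z)
      have hφx (a : Fin r) (j : Fin (r + 1)) :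
          ContMDiffOn I 𝓘(ℝ, ℝ) ∞ (fun z ↦ φ a (x j z)) W :=
        (LinearMap.toContinuousLinearMap (φ a)).contMDiff.comp_contMDiffOn (hx j)
      have hL : ContMDiffOn I 𝓘(ℝ, ℝ) ∞ (fun z ↦ (L z).det) W :=
        contMDiffOn_det fun a b ↦ hφx a _
      have hC (b : Fin r) : ContMDiffOn I 𝓘(ℝ, ℝ) ∞ (fun z ↦ (L z).cramer (g z) b) W := by
        simp only [Matrix.cramer_apply]
        refine contMDiffOn_det fun a j ↦ ?_
        by_cases hj : j = b
        · subst hj; simpa using hφx a _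
        · simpa [Matrix.updateCol_apply, hj, L] using hφx a _
      have hLy : L y = 1 := by
        ext a b
        simp [L, hφ, Matrix.one_apply]
      refine ⟨W ∩ (fun z ↦ (L z).det) ⁻¹' {0}ᶜ, inter_subset_left,
        hL.continuousOn.isOpen_inter_preimage hW isOpen_compl_singleton,
        Fin.snoc (α := fun _ ↦ M → ℝ) (fun b z ↦ -(L z).cramer (g z) b) fun z ↦ (L z).det,
        fun j ↦ ?_, fun z hz ↦ ?_, y, ⟨hy, by simp [hLy]⟩, Fin.last r, by simp [hLy]⟩
      · refine Fin.lastCases ?_ (fun j ↦ ?_) j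
        · simpa using hL.mono inter_subset_left
        · simpa using ((hC j).mono inter_subset_left).neg
      · have hdet : (L z).det ≠ 0 := hz.2
        have hindz : LinearIndependent ℝ fun i : Fin r ↦ x i.castSucc z := by
          rw [Fintype.linearIndependent_iff]
          intro c hc
          have h1 : (L z).mulVec c = 0 := by
            ext a
            have := congrArg (φ a) hc
            simpa [Matrix.mulVec, dotProduct, L, mul_comm] using this
          exact congrFun (Matrix.eq_zero_of_mulVec_eq_zero hdet h1)
        have hspan : x (Fin.last r) z ∈ Submodule.span ℝ (range fun i : Fin r ↦ x i.castSucc z) := by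
          by_contra h
          refine hdep z hz.1 ?_
          rw [linearIndependent_finSucc']
          exact ⟨hindz, h⟩
        obtain ⟨c, hc⟩ := (Submodule.mem_span_range_iff_exists_fun ℝ).1 hspan
        have hg : g z = (L z).mulVec c := by
          ext a
          simp [g, ← hc, Matrix.mulVec, dotProduct, L, mul_comm]
        have hcr : (L z).cramer (g z) = (L z).det • c := by
          rw [Matrix.cramer_eq_adjugate_mulVec, hg, Matrix.mulVec_mulVec, Matrix.adjugate_mul,
            Matrix.smul_mulVec, Matrix.one_mulVec]
        rw [Fin.sum_univ_castSucc]
        simp [hcr, ← hc, Finset.smul_sum, mul_smul]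

end Relations

/-! ### From projectivity to adapted frames -/

section Projective

open Bundle (TotalSpace Trivialization contMDiffAt_section contMDiffWithinAt_section)
open Module Set Topology

variable {E : Type*} [NormedAddCommGroup E] [NormedSpace ℝ E] [FiniteDimensional ℝ E]
  {H : Type*} [TopologicalSpace H] {I : ModelWithCorners ℝ E H}
  {M : Type*} [TopologicalSpace M] [ChartedSpace H M] [IsManifold I ∞ M]

/-! ### Locality of module homomorphisms and local frames. -/

section Locality

variable {F F' : Type*} [NormedAddCommGroup F] [NormedSpace ℝ F]
  [NormedAddCommGroup F'] [NormedSpace ℝ F']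
  {V : M → Type*} [∀ x, AddCommGroup (V x)] [∀ x, Module ℝ (V x)]
  [∀ x, TopologicalSpace (V x)] [TopologicalSpace (Bundle.TotalSpace F V)]
  [FiberBundle F V] [VectorBundle ℝ F V]
  {V' : M → Type*} [∀ x, AddCommGroup (V' x)] [∀ x, Module ℝ (V' x)]
  [∀ x, TopologicalSpace (V' x)] [TopologicalSpace (Bundle.TotalSpace F' V')]
  [FiberBundle F' V'] [VectorBundle ℝ F' V']

theorem coe_sum_smul_apply {P : Submodule C^∞⟮I, M; ℝ⟯ Cₛ^∞⟮I; F, V⟯} {ι : Type*} (t : Finset ι)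
    (c : ι → C^∞⟮I, M; ℝ⟯) (s : ι → P) (x : M) :
    (∑ i ∈ t, c i • s i : P).1 x = ∑ i ∈ t, c i x • (s i).1 x := by
  classical
  induction t using Finset.induction_on with
  | empty => simp
  | insert a t ha ih =>
    rw [Finset.sum_insert ha, Finset.sum_insert ha, ← ih]
    rfl

/-- Module homomorphisms between modules of sections preserve local linear relations with smooth
coefficients. -/
theorem map_apply_eq_sum_of_local [T2Space M] {P : Submodule C^∞⟮I, M; ℝ⟯ Cₛ^∞⟮I; F, V⟯}
    {P' : Submodule C^∞⟮I, M; ℝ⟯ Cₛ^∞⟮I; F', V'⟯} (f : P →ₗ[C^∞⟮I, M; ℝ⟯] P')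
    {U : Set M} (hU : IsOpen U) {ι : Type*} [Fintype ι] {c : ι → M → ℝ}
    (hc : ∀ i, ContMDiffOn I 𝓘(ℝ, ℝ) ∞ (c i) U) {s : P} {σ : ι → P}
    (h : ∀ x ∈ U, s.1 x = ∑ i, c i x • (σ i).1 x) :
    ∀ x ∈ U, (f s).1 x = ∑ i, c i x • (f (σ i)).1 x := by
  intro x hx
  obtain ⟨χ, hχU, -, hχ⟩ := exists_cutoff I x (hU.mem_nhds hx)
  have hχx : χ x = 1 := hχ.self_of_nhds
  -- A cut-off makes the local relation global, so that linearity over smooth functions applies.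
  have h1 : χ • s = ∑ i, cutoffFun χ hU hχU (c i) (hc i) • σ i := by
    apply Subtype.ext
    apply ContMDiffSection.ext
    intro y
    rw [coe_sum_smul_apply]
    change χ y • s.1 y = _
    simp only [cutoffFun_apply, mul_smul, ← Finset.smul_sum]
    by_cases hy : y ∈ U
    · rw [h y hy]
    · have : χ y = 0 := image_eq_zero_of_notMem_tsupport fun h' ↦ hy (hχU h')
      rw [this, zero_smul, zero_smul]
  have h2 := congrArg (fun t ↦ (f t).1 x) h1
  simp only [map_smul, map_sum] at h2
  rw [coe_sum_smul_apply] at h2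
  have h3 : (χ • f s).1 x = χ x • (f s).1 x := rfl
  rw [h3, hχx, one_smul] at h2
  rw [h2]
  refine Finset.sum_congr rfl fun i _ ↦ ?_
  rw [cutoffFun_apply, hχx, one_mul]

/-- Smooth vector bundles have local frames with smooth coefficients. -/
theorem exists_local_frame {r : ℕ} {V : M → Type*} [∀ x, AddCommGroup (V x)]
    [∀ x, Module ℝ (V x)] [∀ x, TopologicalSpace (V x)]
    [TopologicalSpace (Bundle.TotalSpace (EuclideanSpace ℝ (Fin r)) V)]
    [FiberBundle (EuclideanSpace ℝ (Fin r)) V] [VectorBundle ℝ (EuclideanSpace ℝ (Fin r)) V]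
    [ContMDiffVectorBundle ∞ (EuclideanSpace ℝ (Fin r)) V I] (x₀ : M) :
    ∃ (N : Set M) (s : Fin r → ∀ x, V x) (a : Fin r → ∀ x, V x →ₗ[ℝ] ℝ),
      IsOpen N ∧ x₀ ∈ N ∧ (∀ i, SmoothSectionOn I (EuclideanSpace ℝ (Fin r)) (s i) N) ∧
      (∀ (t : Cₛ^∞⟮I; EuclideanSpace ℝ (Fin r), V⟯) (i), ContMDiffOn I 𝓘(ℝ, ℝ) ∞
        (fun x ↦ a i x (t x)) N) ∧
      (∀ x ∈ N, ∀ v : V x, v = ∑ i, a i x v • s i x) ∧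
      ∀ x ∈ N, ∀ i j, a i x (s j x) = if i = j then 1 else 0 := by
  classical
  let e := trivializationAt (EuclideanSpace ℝ (Fin r)) V x₀
  let b := (EuclideanSpace.basisFun (Fin r) ℝ).toBasis
  refine ⟨e.baseSet, e.localFrame b, e.localFrameCoeff I b, e.open_baseSet,
    FiberBundle.mem_baseSet_trivializationAt' x₀, fun i ↦ e.contMDiffOn_localFrame_baseSet ∞ b i,
    fun t i ↦ contMDiffOn_baseSet_localFrameCoeff b t.contMDiff.contMDiffOn i,
    fun x hx v ↦ ?_, fun x hx i j ↦ ?_⟩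
  · have hb := (e.basisAt b hx).sum_repr v
    conv_lhs => rw [← hb]
    refine Finset.sum_congr rfl fun i _ ↦ ?_
    rw [e.localFrame_apply_of_mem_baseSet b hx]
    congr 1
    -- The coefficient formula is stated for sections; this one takes the value `v` at `x`.
    simpa using (e.localFrameCoeff_apply_of_mem_baseSet (I := I) b hx
      (Function.update 0 x v) i).symm
  · rw [e.localFrameCoeff_apply_of_mem_baseSet b hx (e.localFrame b j) i,
      e.localFrame_apply_of_mem_baseSet b hx, Basis.repr_self, Finsupp.single_apply]
    simp only [eq_comm]

end Locality

variable {π : ∀ x : M, ⋀[ℝ]^2 (TangentSpace I x)}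

theorem le_finrank_of_linearIndependent {V : Type*} [AddCommGroup V] [Module ℝ V]
    [FiniteDimensional ℝ V] {w : ⋀[ℝ]^2 V} {r : ℕ} {X : Fin r → V} (hX : LinearIndependent ℝ X)
    (hw : ∀ i, X i ∈ LinearMap.range (sharpHom w)) :
    r ≤ finrank ℝ (LinearMap.range (sharpHom w)) := by
  have h1 := finrank_span_eq_card hX
  rw [Fintype.card_fin] at h1
  rw [← h1]
  refine Submodule.finrank_mono (Submodule.span_le.2 ?_)
  rintro _ ⟨i, rfl⟩
  exact hw i

/-- The generic rank of a projective foliation is at least the rank of the bundle. -/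
theorem dense_rank_le [T2Space M] {A : SmoothVectorBundleOver I M}
    (Φ : poissonFoliation I π ≃ₗ[C^∞⟮I, M; ℝ⟯]
      compactSections I (EuclideanSpace ℝ (Fin A.rank)) A.Fiber) :
    Dense {x : M | A.rank ≤ finrank ℝ (LinearMap.range (sharpHom (π x)))} := by
  rw [dense_iff_inter_open]
  rintro O hO ⟨x₀, hx₀⟩
  by_contra hempty
  rw [not_nonempty_iff_eq_empty] at hempty
  have hlt : ∀ y ∈ O, ¬ A.rank ≤ finrank ℝ (LinearMap.range (sharpHom (π y))) := fun y hy h ↦ by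
    have : y ∈ (∅ : Set M) := hempty ▸ ⟨hy, h⟩
    exact this
  obtain ⟨N, s, a, hN, hxN, hs, -, -, hdual⟩ :=
    exists_local_frame (I := I) (r := A.rank) (V := A.Fiber) x₀
  obtain ⟨ψ, hψN, hψc, hψ⟩ := exists_cutoff I x₀ (hN.mem_nhds hxN)
  let S (i : Fin A.rank) : compactSections I (EuclideanSpace ℝ (Fin A.rank)) A.Fiber :=
    ⟨cutoffSection ψ hN hψN (s i) (hs i), cutoffSection_mem ψ hψc hN hψN (s i) (hs i)⟩
  let X (i : Fin A.rank) : poissonFoliation I π := Φ.symm (S i)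
  -- Where the cut-off equals one, `S i` is the frame section `s i`.
  let W : Set M := (O ∩ (chartAt H x₀).source ∩ N) ∩ interior {y | ψ y = 1}
  have hW : IsOpen W := ((hO.inter (chartAt H x₀).open_source).inter hN).inter isOpen_interior
  have hxW : x₀ ∈ W := ⟨⟨⟨hx₀, mem_chart_source H x₀⟩, hxN⟩, mem_interior_iff_mem_nhds.2 hψ⟩
  have hXrange (i : Fin A.rank) (y : M) : (X i).1 y ∈ LinearMap.range (sharpHom (π y)) := by
    obtain ⟨α, -, hα⟩ := (X i).2
    exact ⟨_, (hα y).symm⟩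
  obtain ⟨W', hW'W, hW', c, hc, hrel, y, hy, i, hi⟩ := exists_smooth_relation (I := I) (F := E)
    (x := fun i y ↦ tcoord I x₀ y ((X i).1 y)) hW ⟨x₀, hxW⟩
    (fun i ↦ (SmoothSectionOn.contMDiffOn_tcoord hO (X i).1.contMDiff.contMDiffOn x₀).mono
      fun y hy ↦ hy.1.1)
    (fun y hy hind ↦ hlt y hy.1.1.1 (le_finrank_of_linearIndependent
      (LinearIndependent.of_comp (tcoord I x₀ y : TangentSpace I y →ₗ[ℝ] E) hind)
      fun i ↦ hXrange i y))
  have h0 : ∀ z ∈ W', (0 : poissonFoliation I π).1 z = ∑ i, c i z • (X i).1 z := by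
    intro z hz
    have h1 := hrel z hz
    simp only [← map_smul, ← map_sum] at h1
    refine (tcoord_injective (I := I) (hW'W hz).1.1.2 ?_).symm
    exact h1.trans (map_zero _).symm
  -- `Φ` carries the relation to the frame of `A`, whose independence kills all coefficients.
  have h1 := map_apply_eq_sum_of_local Φ.toLinearMap hW' hc h0 y hy
  have h2 : ∀ j, (Φ.toLinearMap (X j)).1 y = s j y := fun j ↦ by
    have : Φ.toLinearMap (X j) = S j := Φ.apply_symm_apply (S j)
    rw [this]
    change ψ y • s j y = s j y
    have hψy : ψ y = 1 := interior_subset (s := {y | ψ y = 1}) (hW'W hy).2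
    rw [hψy, one_smul]
  simp only [h2, map_zero] at h1
  have h3 := congrArg (a i y) h1
  simp only [map_sum, map_smul, hdual y (hW'W hy).1.2] at h3
  refine hi ?_
  have h4 : a i y ((0 : compactSections I (EuclideanSpace ℝ (Fin A.rank)) A.Fiber).1 y) = 0 :=
    map_zero _
  rw [h4] at h3
  simpa using h3.symm

/-- If the singular foliation is isomorphic to the sections of a bundle, then there are adapted
frames whose number of elements is the rank of the bundle. -/
theorem hasAdaptedFrames_of_equiv [T2Space M] (hπ : SmoothMultivectorOn I 2 π univ)
    {A : SmoothVectorBundleOver I M}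
    (Φ : poissonFoliation I π ≃ₗ[C^∞⟮I, M; ℝ⟯]
      compactSections I (EuclideanSpace ℝ (Fin A.rank)) A.Fiber) :
    HasAdaptedFrames π A.rank := by
  intro x₀
  obtain ⟨N, s, a, hN, hxN, hs, ha, hsum, hdual⟩ :=
    exists_local_frame (I := I) (r := A.rank) (V := A.Fiber) x₀
  have hC : IsOpen (chartAt H x₀).source := (chartAt H x₀).open_source
  obtain ⟨ψ, hψN', hψc, hψ⟩ := exists_cutoff I x₀
    ((hN.inter hC).mem_nhds ⟨hxN, mem_chart_source H x₀⟩)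
  have hψN : tsupport ψ ⊆ N := hψN'.trans inter_subset_left
  have hψC : tsupport ψ ⊆ (chartAt H x₀).source := hψN'.trans inter_subset_right
  let b := Module.finBasis ℝ E
  let G := sharpModuleHom hπ
  let S (i : Fin A.rank) : compactSections I (EuclideanSpace ℝ (Fin A.rank)) A.Fiber :=
    ⟨cutoffSection ψ hN hψN (s i) (hs i), cutoffSection_mem ψ hψc hN hψN (s i) (hs i)⟩
  choose α hα using fun i ↦ sharpModuleHom_surjective hπ (Φ.symm (S i))
  let ξ (j : Fin (finrank ℝ E)) := LinearMap.toContinuousLinearMap (b.coord j)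
  let β (j : Fin (finrank ℝ E)) :
      compactSections I (E →L[ℝ] ℝ) (fun x : M ↦ CotangentSpace I x) :=
    ⟨cutoffSection ψ hC hψC (constForm x₀ (ξ j)) (smoothSectionOn_constForm x₀ (ξ j)),
      cutoffSection_mem ψ hψc hC hψC _ (smoothSectionOn_constForm x₀ (ξ j))⟩
  let Θ (j : Fin (finrank ℝ E)) : compactSections I (EuclideanSpace ℝ (Fin A.rank)) A.Fiber :=
    Φ (G (β j))
  let U : Set M := (N ∩ (chartAt H x₀).source) ∩ interior {y | ψ y = 1}
  have hU : IsOpen U := (hN.inter hC).inter isOpen_interior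
  have hUN : U ⊆ N := fun y hy ↦ hy.1.1
  have hUC : U ⊆ (chartAt H x₀).source := fun y hy ↦ hy.1.2
  have hU1 : ∀ y ∈ U, ψ y = 1 := fun y hy ↦ interior_subset (s := {y | ψ y = 1}) hy.2
  have hSU : ∀ y ∈ U, ∀ i, (S i).1 y = s i y := fun y hy i ↦ by
    change ψ y • s i y = s i y
    rw [hU1 y hy, one_smul]
  have hβU : ∀ y ∈ U, ∀ j, (β j).1 y = constForm x₀ (ξ j) y := fun y hy j ↦ by
    change ψ y • constForm x₀ (ξ j) y = _
    rw [hU1 y hy, one_smul]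
  have hform : ∀ y ∈ U, ∀ γ : CotangentSpace I y,
      γ = ∑ j, (γ (tcoordSymm I x₀ y (b j)) : ℝ) • (β j).1 y := by
    intro y hy γ
    ext v
    have h1 : v = ∑ j, b.coord j (tcoord I x₀ y v) • tcoordSymm I x₀ y (b j) := by
      conv_lhs => rw [← tcoordSymm_tcoord (hUC hy) v, ← b.sum_repr (tcoord I x₀ y v)]
      simp only [map_sum, map_smul, Basis.coord_apply]
    conv_lhs => rw [h1]
    rw [_root_.sum_apply, map_sum]
    refine Finset.sum_congr rfl fun j _ ↦ ?_
    rw [map_smul, hβU y hy]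
    exact mul_comm _ _
  have hTsmooth (i j) : ContMDiffOn I 𝓘(ℝ, ℝ) ∞ (fun y ↦ a i y ((Θ j).1 y)) U :=
    (ha (Θ j).1 i).mono hUN
  -- Pairing with `Y i` is the `i`-th component of `Φ ∘ π♯`, read off from its values on the
  -- coordinate forms.
  let Y (i : Fin A.rank) (y : M) : TangentSpace I y :=
    ∑ j, a i y ((Θ j).1 y) • tcoordSymm I x₀ y (b j)
  have hpair (y : M) (γ : TangentSpace I y →ₗ[ℝ] ℝ) (i : Fin A.rank) :
      γ (Y i y) = ∑ j, γ (tcoordSymm I x₀ y (b j)) * a i y ((Θ j).1 y) := by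
    simp only [Y, map_sum, map_smul, smul_eq_mul, mul_comm]
  refine ⟨U, Y, fun i y ↦ (α i).1 y, ⟨⟨hxN, mem_chart_source H x₀⟩,
    mem_interior_iff_mem_nhds.2 hψ⟩, hU, fun i ↦ ?_, fun i ↦ (α i).1.contMDiff.contMDiffOn, ?_, ?_⟩
  · exact SmoothSectionOn.sum fun j _ ↦ SmoothSectionOn.smul (hTsmooth i j)
      ((smoothSectionOn_tcoordSymm_const x₀ (b j)).mono hUC)
  · intro y hy l m
    have h1 := map_apply_eq_sum_of_local (Φ.toLinearMap ∘ₗ G) hU (s := α l) (σ := β)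
      (c := fun j z ↦ ((α l).1 z (tcoordSymm I x₀ z (b j)) : ℝ))
      (fun j ↦ SmoothSectionOn.pairing (α l).1.contMDiff.contMDiffOn
        ((smoothSectionOn_tcoordSymm_const x₀ (b j)).mono hUC))
      (fun z hz ↦ hform z hz ((α l).1 z)) y hy
    have h2 : (Φ.toLinearMap ∘ₗ G) (α l) = S l := by
      rw [LinearMap.comp_apply, hα l]
      exact Φ.apply_symm_apply _
    rw [h2, hSU y hy] at h1
    have h3 := congrArg (a m y) h1
    rw [hdual y (hUN hy)] at h3
    simp only [map_sum, map_smul, smul_eq_mul] at h3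
    simp only [eq_comm (a := l)]
    rw [h3]
    exact hpair y ((α l).1 y : TangentSpace I y →ₗ[ℝ] ℝ) m
  · intro y hy γ
    -- Expanding `Φ(π♯β)` in the frame and applying `Φ⁻¹`, which is local too, writes `π♯β` through
    -- the fields `Φ⁻¹(S i) = π♯(α i)`.
    have h1 : ∀ j, (G (β j)).1 y = ∑ i, a i y ((Θ j).1 y) • (Φ.symm (S i)).1 y := by
      intro j
      have h := map_apply_eq_sum_of_local Φ.symm.toLinearMap hU (s := Θ j) (σ := S)
        (c := fun i z ↦ a i z ((Θ j).1 z)) (fun i ↦ hTsmooth i j)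
        (fun z hz ↦ by simp only [hSU z hz]; exact hsum z (hUN hz) _) y hy
      have h' : Φ.symm.toLinearMap (Θ j) = G (β j) := Φ.symm_apply_apply _
      rw [h'] at h
      exact h
    have h2 : γ = ∑ j, γ (tcoordSymm I x₀ y (b j)) • ((β j).1 y : TangentSpace I y →ₗ[ℝ] ℝ) := by
      have h := hform y hy (LinearMap.toContinuousLinearMap (E := E) (F' := ℝ) γ : E →L[ℝ] ℝ)
      ext v
      have h' := congrArg (fun δ : CotangentSpace I y ↦ (δ v : ℝ)) h
      simp only [_root_.sum_apply] at h'
      rw [LinearMap.sum_apply]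
      exact h'
    conv_lhs => rw [h2]
    rw [← sharpHom_apply, map_sum]
    simp only [map_smul, sharpHom_apply, ← sharpModuleHom_apply hπ]
    change ∑ j, γ (tcoordSymm I x₀ y (b j)) • (G (β j)).1 y = _
    simp only [h1, hα, Finset.smul_sum, smul_smul]
    rw [Finset.sum_comm]
    refine Finset.sum_congr rfl fun i _ ↦ ?_
    rw [← Finset.sum_smul, hpair]

end Projective

/-! ### The equivalence. -/

theorem proposition2p8 {n : ℕ} {M : Type*} [TopologicalSpace M] [T2Space M]
    [SecondCountableTopology M] [ChartedSpace (EuclideanSpace ℝ (Fin n)) M]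
    [IsManifold (𝓡 n) ∞ M]
    (π : ∀ x : M, ⋀[ℝ]^2 (TangentSpace (𝓡 n) x)) (hπ : IsPoisson (𝓡 n) π)
    (k : ℕ) (hk : ∃ x : M, wedgePow (π x) k ≠ 0) (hk' : ∀ x : M, wedgePow (π x) (k + 1) = 0) :
    IsAlmostRegular (𝓡 n) π ↔
      Dense {x : M | wedgePow (π x) k ≠ 0} ∧
      ∃ K : ∀ x : M, Submodule ℝ (⋀[ℝ]^(2 * k) (TangentSpace (𝓡 n) x)),
        IsLineSubbundle (𝓡 n) (2 * k) K ∧ ∀ x : M, wedgePow (π x) k ∈ K x := by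
  -- With second countability this yields σ-compactness, needed for partitions of unity.
  have : LocallyCompactSpace M := ChartedSpace.locallyCompactSpace (EuclideanSpace ℝ (Fin n)) M
  constructor
  · rintro ⟨A, ⟨Φ⟩⟩
    have hF := hasAdaptedFrames_of_equiv hπ.smooth Φ
    have hrank := dense_rank_le Φ
    obtain ⟨x₁, hx₁⟩ := hk
    have : Nonempty M := ⟨x₁⟩
    -- The upper bound comes from `∧^(k+1)π = 0` at a point where the rank is at least that of `A`,
    -- the lower one from an adapted frame at a point where `∧^kπ ≠ 0`.
    have hr : A.rank = 2 * k := by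
      apply le_antisymm
      · obtain ⟨x, hx⟩ := hrank.nonempty
        exact Nat.lt_succ_iff.1 (lt_of_le_of_lt hx (finrank_range_sharp_lt (hk' x)))
      · obtain ⟨U, Y, α, hxU, h⟩ := hF x₁
        exact le_of_wedgePow_ne_zero hx₁ (fun l ↦ Y l x₁)
          (bivectorSharp_mem_span_of_adapted (h.sharp_eq x₁ hxU))
    rw [hr] at hF hrank
    have hd : Dense {x : M | wedgePow (π x) k ≠ 0} :=
      hrank.mono fun x hx ↦ wedgePow_ne_zero_of_le_finrank hx
    exact ⟨hd, exists_lineSubbundle_of_hasAdaptedFrames hd hF⟩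
  · rintro ⟨hd, K, hK, hmem⟩
    exact isAlmostRegular_of_hasAdaptedFrames hπ.smooth hd
      (hasAdaptedFrames_of_lineSubbundle hπ.smooth hk' hd hK hmem)
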